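/- Let $C_1$ and $C_2$ be classical binary convolutional codes with $n$ bits per frame and with realizable rational, delay-free, noncatastrophic encoders $G_1(D)$ ($k_1\times n$) and $G_2(D)$ ($k_2\times n$). (Delay-free: $G_i(0)$ has full row rank. Noncatastrophic: information sequences in $\mathbb F_2((D))^{k_i}$ with finite-weight output have finite weight. $C_i$ is the set of all outputs $u(D)G_i(D)$, $u\in\mathbb F_2((D))^{k_i}$.) Let $H_1(D)$ and $H_2(D)$ be polynomial check matrices of $C_1$ and $C_2$, of dimensions $(n-k_1)\times n$ and $(n-k_2)\times n$, that is, $v\in C_i$ if and only if $H_i(D)v(D)^T=0$. Let $c$ be the rank of $H_1(D)H_2^T(D^{-1})$ over the field $\mathbb F_2(D)$. Then $k_1+k_2-n+c\ge 0$, and the quantum check matrix (with the "$Z$" side on the left and the "$X$" side on the right) $$H(D)=\left[\begin{array}{c|c}H_1(D)&0\\0&H_2(D)\end{array}\right]$$ gives an $[[n,\,k_1+k_2-n+c;\,c]]$ entanglement-assisted quantum convolutional code. Moreover the code requires $c$ ebits per frame: if finitely supported "$Z$" and "$X$" columns for $c'$ noiseless receiver qubits per frame are added to $H(D)$ so that all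 the resulting generators and all their frame shifts commute, then $c'\ge c$. Here $H(D)$ gives an $[[n,k;c]]$ entanglement-assisted quantum convolutional code if the following holds, where Pauli sequences are taken modulo phases and written as vectors $(z(D)|x(D))$ of binary Laurent polynomials or rational functions, and $D$ is the delay by one frame. In each frame the sender has $k$ information qubits, $n-k-c$ ancilla qubits (stabilized by $Z$) and her halves of $c$ ebits shared with the receiver (stabilized by $ZZ$ and $XX$). 1. There is an encoding circuit on the sender's $n$ qubits per frame, made of finite-depth gates of the shift-invariant Clifford group (CNOT and controlled-phase gates between frames at any delay, Hadamard gates, phase gates, delays of single qubits) and of infinite-depth operations $1/f(D)$, $f\ne0$ a Laurent polynomial, which multiply one "$X$" column by $1/f(D)$ and the corresponding "$Z$" column by $f(D^{-1})$. 2. The encoded stabilizer is taken by row operations (premultiplication by a square matrix of Laurent polynomials with nonzero determinant) to a matrix of finite-weight, mutually commuting generators, for the receiver to measure, whose columns for the sender's qubits form exactly $H(D)$. 3. There is a decoding circuit of finite-depth gates only, on all $n+c$ qubits per frame, that recovers the information qubits: up to multiplication by finite products of elements of the stabilizer, it takes the encoded logical operators of the $k$ information qubits back to the original ones. -/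

import Mathlib

noncomputable section

namespace QConv

/-! ### Classical binary convolutional codes -/

/-- Sequences of bits with finitely many terms in the past: formal Laurent series in `D`. -/
abbrev Seq : Type := LaurentSeries (ZMod 2)

/-- The expansion of a rational function of `D` as a formal Laurent series in `D`: the extension of
the inclusion of the polynomials. -/
def expand : RatFunc (ZMod 2) →+* Seq :=
  IsFractionRing.lift (FaithfulSMul.algebraMap_injective (Polynomial (ZMod 2)) Seq)

/-- Every entry `p(D)/q(D)` (in lowest terms) of the transfer matrix has `q(0) ≠ 0`, so that it
expands into a power series, i.e. it is realized by a causal finite-state circuit. Polynomial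
transfer matrices are the special case `q = 1`. -/
def Realizable {k n : ℕ} (G : Matrix (Fin k) (Fin n) (RatFunc (ZMod 2))) : Prop :=
  ∀ i j, (G i j).denom.eval 0 ≠ 0

/-- The encoder is delay-free: the constant matrix `G(0)` has full row rank. -/
def DelayFree {k n : ℕ} (G : Matrix (Fin k) (Fin n) (RatFunc (ZMod 2))) : Prop :=
  LinearIndependent (ZMod 2) (fun i j => (G i j).eval (RingHom.id (ZMod 2)) 0)

/-- The output `u(D) G(D)` of the encoder `G(D)` on the information sequences `u(D)`. -/
def encodeSeq {k n : ℕ} (G : Matrix (Fin k) (Fin n) (RatFunc (ZMod 2))) (u : Fin k → Seq) :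
    Fin n → Seq :=
  Matrix.vecMul u (G.map expand)

/-- The encoder is noncatastrophic: an information sequence that yields a code sequence of finite
weight has finite weight itself. -/
def Noncatastrophic {k n : ℕ} (G : Matrix (Fin k) (Fin n) (RatFunc (ZMod 2))) : Prop :=
  ∀ u : Fin k → Seq, (∀ j, (encodeSeq G u j).support.Finite) → ∀ i, (u i).support.Finite

/-- The convolutional code generated by the encoder `G(D)`: the set of all its outputs. -/
def convCode {k n : ℕ} (G : Matrix (Fin k) (Fin n) (RatFunc (ZMod 2))) : Set (Fin n → Seq) :=
  Set.range (encodeSeq G)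

/-- The polynomial matrix `H(D)` is a check matrix of `C`: the code sequences `v(D)` are exactly
those with `H(D) v(D)ᵀ = 0`. -/
def IsCheckMatrix {r n : ℕ} (H : Matrix (Fin r) (Fin n) (Polynomial (ZMod 2)))
    (C : Set (Fin n → Seq)) : Prop :=
  ∀ v : Fin n → Seq, v ∈ C ↔ (H.map (algebraMap (Polynomial (ZMod 2)) Seq)).mulVec v = 0

/-! ### Pauli sequences as binary polynomials

For a set `Q` of qubits per frame, a row vector indexed by `Q ⊕ Q` is a phase-free Pauli sequence
`(z(D) | x(D))`: the index `inl q` is column `q` of the "Z" side, `inr q` is column `q` of the "X"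
side, and the coefficient of `D ^ t` is the exponent of `Z`, or of `X`, on qubit `q` of frame `t`.
Laurent polynomial entries mean finite weight; a rational entry is a Pauli sequence of infinite
weight. -/

/-- Binary Laurent polynomials in `D`. -/
abbrev Lau : Type := LaurentPolynomial (ZMod 2)

/-- Binary rational functions in `D`. -/
abbrev Rat2 : Type := FractionRing Lau

/-- The power `D ^ l` of the delay operator, as a rational function. -/
def delayPow (l : ℤ) : Rat2 := algebraMap Lau Rat2 (LaurentPolynomial.T l)

/-- The time reversal `f(D) ↦ f(D⁻¹)` of rational functions. -/
def timeRev : Rat2 ≃+* Rat2 :=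
  IsFractionRing.ringEquivOfRingEquiv (LaurentPolynomial.invert (R := ZMod 2)).toRingEquiv

/-- A Laurent polynomial matrix as a matrix of rational functions. -/
def toRat {ρ κ : Type} (M : Matrix ρ κ Lau) : Matrix ρ κ Rat2 := M.map (algebraMap Lau Rat2)

/-- The shifted symplectic product
`(v ⊙ w)(D) = z_v(D⁻¹) · x_w(D) + x_v(D⁻¹) · z_w(D)`. -/
def shiftedSymp {Q : Type} [Fintype Q] (v w : Q ⊕ Q → Lau) : Lau :=
  ∑ q, (LaurentPolynomial.invert (v (Sum.inl q)) * w (Sum.inr q)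
    + LaurentPolynomial.invert (v (Sum.inr q)) * w (Sum.inl q))

/-- All the generators given by the rows of `M`, and all their shifts by frames, commute. -/
def Commuting {ρ Q : Type} [Fintype Q] (M : Matrix ρ (Q ⊕ Q) Lau) : Prop :=
  ∀ r r', shiftedSymp (M r) (M r') = 0

/-! ### Shift-invariant Clifford circuits -/

/-- The finite-depth gates of the shift-invariant Clifford group; a gate acts in every frame. -/
inductive FinGate (Q : Type) : Type
  /-- CNOT from qubit `i` to qubit `j` in the frame delayed by `l` -/
  | cnot (i j : Q) (h : i ≠ j) (l : ℤ)
  /-- Hadamard gate on qubit `i` -/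
  | hadamard (i : Q)
  /-- phase gate on qubit `i` -/
  | phase (i : Q)
  /-- controlled-phase gate from qubit `i` to qubit `j` in the frame delayed by `l` -/
  | cphase (i j : Q) (h : i ≠ j) (l : ℤ)
  /-- controlled-phase gate from qubit `i` to qubit `i` in the frame delayed by `l` -/
  | cphaseSelf (i : Q) (l : ℤ)
  /-- delay qubit `i` by `l` frames (advance it if `l < 0`) -/
  | delay (i : Q) (l : ℤ)

/-- The gates of an encoding circuit: the finite-depth gates and the infinite-depth operations. -/
inductive Gate (Q : Type) : Type
  | fin (g : FinGate Q)
  /-- the infinite-depth operation `1/f(D)` on qubit `i` -/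
  | inf (i : Q) (f : Lau) (hf : f ≠ 0)

/-- The column operation performed by a finite-depth gate: the Pauli sequence `v` becomes the row
vector `v * g.mat`. Right multiplication by `1 + single a b f` multiplies column `a` by `f` and adds
the result to column `b`. -/
def FinGate.mat {Q : Type} [DecidableEq Q] : FinGate Q → Matrix (Q ⊕ Q) (Q ⊕ Q) Rat2
  | .cnot i j _ l => 1 + Matrix.single (Sum.inr i) (Sum.inr j) (delayPow l)
      + Matrix.single (Sum.inl j) (Sum.inl i) (delayPow (-l))
  | .hadamard i => (Equiv.swap (Sum.inl i) (Sum.inr i)).permMatrix Rat2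
  | .phase i => 1 + Matrix.single (Sum.inr i) (Sum.inl i) 1
  | .cphase i j _ l => 1 + Matrix.single (Sum.inr i) (Sum.inl j) (delayPow l)
      + Matrix.single (Sum.inr j) (Sum.inl i) (delayPow (-l))
  | .cphaseSelf i l => 1 + Matrix.single (Sum.inr i) (Sum.inl i) (delayPow l + delayPow (-l))
  | .delay i l => Matrix.diagonal
      (Sum.elim (fun q => if q = i then delayPow l else 1) (fun q => if q = i then delayPow l else 1))

/-- The column operation performed by a gate. The infinite-depth operation `1/f(D)` on qubit `i`
multiplies column `i` by `1/f(D)` on the "X" side and by `f(D⁻¹)` on the "Z" side. -/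
def Gate.mat {Q : Type} [DecidableEq Q] : Gate Q → Matrix (Q ⊕ Q) (Q ⊕ Q) Rat2
  | .fin g => g.mat
  | .inf i f _ => Matrix.diagonal
      (Sum.elim (fun q => if q = i then timeRev (algebraMap Lau Rat2 f) else 1)
        (fun q => if q = i then (algebraMap Lau Rat2 f)⁻¹ else 1))

/-- The effect of a circuit of finite-depth gates, performed in the order of the list. -/
def finCircuitMat {Q : Type} [Fintype Q] [DecidableEq Q] (gs : List (FinGate Q)) :
    Matrix (Q ⊕ Q) (Q ⊕ Q) Rat2 :=
  (gs.map FinGate.mat).prod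

/-- The effect of a circuit, performed in the order of the list. -/
def circuitMat {Q : Type} [Fintype Q] [DecidableEq Q] (gs : List (Gate Q)) :
    Matrix (Q ⊕ Q) (Q ⊕ Q) Rat2 :=
  (gs.map Gate.mat).prod

/-- An operation on the sender's qubits `A`, as an operation on the receiver's qubits `B` and the
sender's qubits `A` together that does nothing to the receiver's qubits. -/
def onSender {A : Type} (B : Type) [DecidableEq B]
    (E : Matrix (A ⊕ A) (A ⊕ A) Rat2) :
    Matrix ((B ⊕ A) ⊕ (B ⊕ A)) ((B ⊕ A) ⊕ (B ⊕ A)) Rat2 :=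
  (Matrix.fromBlocks (1 : Matrix (B ⊕ B) (B ⊕ B) Rat2) 0 0 E).submatrix
    (Equiv.sumSumSumComm B A B A) (Equiv.sumSumSumComm B A B A)

/-- The columns of the sender's qubits in a matrix for the qubits of both parties. -/
def senderPart {ρ A B R : Type} (M : Matrix ρ ((B ⊕ A) ⊕ (B ⊕ A)) R) : Matrix ρ (A ⊕ A) R :=
  M.submatrix id (Sum.map Sum.inr Sum.inr)

/-! ### Entanglement-assisted quantum convolutional codes -/

/-- The Pauli sequence with one `Z`, on qubit `q` of frame `0`. -/
def pauliZ {Q : Type} [DecidableEq Q] (q : Q) : Q ⊕ Q → Rat2 := Pi.single (Sum.inl q) 1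

/-- The Pauli sequence with one `X`, on qubit `q` of frame `0`. -/
def pauliX {Q : Type} [DecidableEq Q] (q : Q) : Q ⊕ Q → Rat2 := Pi.single (Sum.inr q) 1

/-- The stabilizer of the unencoded stream. In each frame the receiver holds `c` qubits and the
sender holds `n` qubits, which `lab` divides into her halves of `c` ebits, `a` ancilla qubits and `k`
information qubits. The generators are `ZZ` and `XX` for each ebit and `Z` for each ancilla. -/
def bareStabilizer {n k a c : ℕ} (lab : Fin c ⊕ Fin a ⊕ Fin k ≃ Fin n) :
    Matrix (Fin c ⊕ Fin c ⊕ Fin a) ((Fin c ⊕ Fin n) ⊕ (Fin c ⊕ Fin n)) Rat2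
  | Sum.inl i => pauliZ (Sum.inl i) + pauliZ (Sum.inr (lab (Sum.inl i)))
  | Sum.inr (Sum.inl i) => pauliX (Sum.inl i) + pauliX (Sum.inr (lab (Sum.inl i)))
  | Sum.inr (Sum.inr j) => pauliZ (Sum.inr (lab (Sum.inr (Sum.inl j))))

/-- The information-qubit matrix of the unencoded stream: the logical operators `Z` and `X` of the
`k` information qubits. -/
def bareLogical {n k a c : ℕ} (lab : Fin c ⊕ Fin a ⊕ Fin k ≃ Fin n) :
    Matrix (Fin k ⊕ Fin k) ((Fin c ⊕ Fin n) ⊕ (Fin c ⊕ Fin n)) Rat2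
  | Sum.inl i => pauliZ (Sum.inr (lab (Sum.inr (Sum.inr i))))
  | Sum.inr i => pauliX (Sum.inr (lab (Sum.inr (Sum.inr i))))

/-- `S` and `M` are related by row operations that take the rows of `S` to the finite-weight rows of
`M`: premultiplication by a nonsingular matrix of Laurent polynomials, that is, by a product of
elementary row operations, multiplications of a row by a power of `D`, and multiplications of a row
by a nonzero polynomial. -/
def RowReducesTo {σ ρ κ : Type} [Fintype ρ] [DecidableEq ρ] (S : Matrix σ κ Rat2)
    (M : Matrix ρ κ Lau) : Prop :=
  ∃ (e : ρ ≃ σ) (P : Matrix ρ ρ Lau), P.det ≠ 0 ∧ toRat P * S.submatrix e id = toRat M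

/-- The quantum check matrix `H`, for `n` qubits per frame, gives an `[[n, k; c]]`
entanglement-assisted quantum convolutional code.

The sender starts from the stream with `c` ebits, `n - k - c` ancilla qubits and `k` information
qubits per frame, and encodes it by a circuit `enc` on her own `n` qubits per frame. The encoded
stabilizer is equivalent by row operations to a commuting matrix `M` of finite-weight generators,
which the receiver measures, and `M` restricted to the sender's qubits is `H`. A finite-depth circuit
`dec` on all `n + c` qubits then returns the information qubits: up to multiplication by (finite
products of) elements of the stabilizer, their logical operators become the unencoded ones. -/
def IsEAQCC (n k c : ℕ) {ρ : Type} [Fintype ρ] [DecidableEq ρ]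
    (H : Matrix ρ (Fin n ⊕ Fin n) Lau) : Prop :=
  ∃ (lab : Fin c ⊕ Fin (n - k - c) ⊕ Fin k ≃ Fin n)
    (enc : List (Gate (Fin n)))
    (dec : List (FinGate (Fin c ⊕ Fin n)))
    (M : Matrix ρ ((Fin c ⊕ Fin n) ⊕ (Fin c ⊕ Fin n)) Lau)
    (R : Matrix (Fin k ⊕ Fin k) (Fin c ⊕ Fin c ⊕ Fin (n - k - c)) Lau),
    senderPart M = H ∧ Commuting M ∧
    RowReducesTo (bareStabilizer lab * onSender (Fin c) (circuitMat enc)) M ∧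
    bareLogical lab * onSender (Fin c) (circuitMat enc) * finCircuitMat dec
      = bareLogical lab + toRat R *
        (bareStabilizer lab * onSender (Fin c) (circuitMat enc) * finCircuitMat dec)

/-! ### The CSS construction -/

/-- The quantum check matrix in CSS form: `H₁(D)` on the "Z" side and `H₂(D)` on the "X" side. -/
def cssMatrix {r₁ r₂ n : ℕ} (H₁ : Matrix (Fin r₁) (Fin n) (Polynomial (ZMod 2)))
    (H₂ : Matrix (Fin r₂) (Fin n) (Polynomial (ZMod 2))) :
    Matrix (Fin r₁ ⊕ Fin r₂) (Fin n ⊕ Fin n) Lau :=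
  Matrix.fromBlocks (H₁.map Polynomial.toLaurent) 0 0 (H₂.map Polynomial.toLaurent)

/-- The matrix `H₁(D) H₂ᵀ(D⁻¹)`. -/
def crossMatrix {r₁ r₂ n : ℕ} (H₁ : Matrix (Fin r₁) (Fin n) (Polynomial (ZMod 2)))
    (H₂ : Matrix (Fin r₂) (Fin n) (Polynomial (ZMod 2))) : Matrix (Fin r₁) (Fin r₂) Lau :=
  H₁.map Polynomial.toLaurent *
    (H₂.map fun p => LaurentPolynomial.invert (Polynomial.toLaurent p)).transpose

/-- The number of ebits per frame: the rank of `H₁(D) H₂ᵀ(D⁻¹)` over the field of rational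
functions. -/
def ebitRank {r₁ r₂ n : ℕ} (H₁ : Matrix (Fin r₁) (Fin n) (Polynomial (ZMod 2)))
    (H₂ : Matrix (Fin r₂) (Fin n) (Polynomial (ZMod 2))) : ℕ :=
  (toRat (crossMatrix H₁ H₂)).rank

end QConv

end

/-!
The theorem is linear algebra over the principal ideal domain `Lau` of Laurent polynomials and its
fraction field `Rat2`. With the time reversal `D ↦ D⁻¹` as star operation, "Z" and "X" generators
commute, together with all their shifts, exactly if the product of one matrix with the conjugate
transpose of the other vanishes, so that `crossMatrix H₁ H₂ = H₁ * H₂ᴴ` records what fails to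
commute. The check matrices enter through their full rank `n - kᵢ` (`rank_of_isCheckMatrix`). The
row operations allowed in `RowReducesTo` are nonsingular but need not be unimodular, so that all
of the linear algebra on the rows can be done over `Rat2`.

*Adding ebits.* A rank factorization `H₁ * H₂ᴴ = B * C` over the principal ideal domain, with
inner dimension the rank `c`, gives the receiver's columns: the extended generators
`M₁ = (B | H₁)`, `M₂ = (Cᴴ | H₂)` commute, since `B * C + B * C = 0` in characteristic two.
Completing `B` and `Cᴴ` to nonsingular matrices `P₁`, `P₂` yields rational generators
`Z = P₁⁻¹ * H₁`, `X = P₂⁻¹ * H₂` that consist of `c` anticommuting pairs and otherwise commute (`exists_normalForm`).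

*Decoder.* Column echelon reduction by the Euclidean algorithm, first of `M₁` and then of `M₂` on
the columns that `M₁` leaves free, is a finite-depth CNOT circuit that moves all the extended
generators off the information qubits (`exists_shears_pair`). Its inverse carries the bare logical
operators to finite-weight operators `F`, `F'` that commute with the extended generators.
Multiplying `F`, `F'` by ebit stabilizers removes their receiver's parts and leaves the encoded
logical operators.

*Encoder.* The rows of `Z` and `X` and these logical operators are completed to a pair of dual
bases of the sender's space over `Rat2` (`exists_dual_completion`). Thanks to the infinite-depth
operations, every invertible rational matrix is performed by a circuit (`encodes_of_det_ne_zero`),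
being a product of transvections and a diagonal matrix. Hadamard gates prepare the ancillas that
become "X" generators.

*Optimality.* In any commuting extension the receiver's parts of the first generators span an
isotropic subspace of a symplectic space of dimension `2c'`, so their rank is at most `c'`, and it
bounds the rank of `H₁ * H₂ᴴ` (`rank_le_of_commuting`).
-/

noncomputable section

namespace QConv

open Matrix

/-! ### Matrices over fields and principal ideal domains -/

theorem exists_rightInverse_of_rank {F ρ κ : Type*} [Field F] [Fintype ρ] [DecidableEq ρ]
    [Fintype κ] [DecidableEq κ] (A : Matrix ρ κ F) (h : A.rank = Fintype.card ρ) :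
    ∃ N : Matrix κ ρ F, A * N = 1 := by
  rw [← Matrix.mulVec_surjective_iff_exists_right_inverse]
  have h1 : LinearMap.range A.mulVecLin = ⊤ := by
    apply Submodule.eq_top_of_finrank_eq
    rw [Module.finrank_fintype_fun_eq_card, ← h, Matrix.rank]
  intro v
  have : v ∈ LinearMap.range A.mulVecLin := by rw [h1]; trivial
  exact this

theorem linearIndependent_map_row {R : Type*} [CommRing R] [IsDomain R]
    (F : Type*) [Field F] [Algebra R F] [IsFractionRing R F] {ρ κ : Type} {A : Matrix ρ κ R}
    (h : LinearIndependent R A.row) : LinearIndependent F (A.map (algebraMap R F)).row := by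
  rw [← LinearIndependent.iff_fractionRing (R := R)]
  have hinj : Function.Injective (LinearMap.compLeft (Algebra.linearMap R F) κ) := fun v w h => by
    funext j
    exact IsFractionRing.injective R F (congrFun h j)
  exact h.map' _ (LinearMap.ker_eq_bot.2 hinj)

theorem rank_eq_card_of_rightInverse {F ρ κ : Type*} [Field F] [Fintype ρ] [DecidableEq ρ]
    [Fintype κ] {A : Matrix ρ κ F} {N : Matrix κ ρ F} (h : A * N = 1) :
    A.rank = Fintype.card ρ := by
  apply le_antisymm (Matrix.rank_le_card_height A)
  rw [← Matrix.rank_one (R := F) (n := ρ), ← h]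
  exact Matrix.rank_mul_le_left _ _

theorem exists_rank_factorization {R : Type*} [CommRing R] [IsDomain R] [IsPrincipalIdealRing R]
    (F : Type*) [Field F] [Algebra R F] [IsFractionRing R F] {ρ₁ ρ₂ : Type} [Fintype ρ₁]
    [Fintype ρ₂] (A : Matrix ρ₁ ρ₂ R) (c : ℕ) (hc : (A.map (algebraMap R F)).rank = c) :
    ∃ (B : Matrix ρ₁ (Fin c) R) (C : Matrix (Fin c) ρ₂ R), A = B * C := by
  classical
  set W : Submodule R (ρ₂ → R) := Submodule.span R (Set.range A.row) with hW
  obtain ⟨m, b⟩ := Submodule.basisOfPid (Pi.basisFun R ρ₂) W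
  let C : Matrix (Fin m) ρ₂ R := Matrix.of fun i => (b i : ρ₂ → R)
  let B : Matrix ρ₁ (Fin m) R := Matrix.of fun r => b.repr ⟨A r, Submodule.subset_span ⟨r, rfl⟩⟩
  have hA : A = B * C := by
    ext r j
    have := congrArg (fun w : W => (w : ρ₂ → R) j)
      (b.sum_repr ⟨A r, Submodule.subset_span ⟨r, rfl⟩⟩)
    simp only [Submodule.coe_sum, Submodule.coe_smul, Finset.sum_apply, Pi.smul_apply,
      smul_eq_mul] at this
    rw [← this, Matrix.mul_apply]
    rfl
  have hC : ∃ X : Matrix (Fin m) ρ₁ R, C = X * A := by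
    have : ∀ i, ∃ x : ρ₁ → R, ∑ r, x r • A.row r = C.row i := fun i => by
      exact (Submodule.mem_span_range_iff_exists_fun R).1 (b i).2
    choose X hX using this
    refine ⟨Matrix.of X, ?_⟩
    ext i j
    rw [Matrix.mul_apply, ← Matrix.row_apply C, ← hX i, Finset.sum_apply]
    rfl
  obtain ⟨X, hX⟩ := hC
  have hli : LinearIndependent R C.row := b.linearIndependent.map' W.subtype (by simp)
  have hli' := linearIndependent_map_row F hli
  have hm : m = c := by
    have h1 : (C.map (algebraMap R F)).rank = m := by simpa using hli'.rank_matrix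
    apply le_antisymm
    · rw [← h1, ← hc, hX, Matrix.map_mul]
      exact Matrix.rank_mul_le_right _ _
    · rw [← h1, ← hc, hA, Matrix.map_mul]
      exact Matrix.rank_mul_le_right _ _
  subst hm
  exact ⟨B, C, hA⟩

theorem rank_map_le {F ρ₁ ρ₂ : Type} [Field F] [Fintype ρ₁] [Fintype ρ₂] (f : F →+* F)
    (A : Matrix ρ₁ ρ₂ F) : (A.map f).rank ≤ A.rank := by
  obtain ⟨B, C, h⟩ := exists_rank_factorization F A A.rank (by simp)
  conv_lhs => rw [h, Matrix.map_mul]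
  exact (Matrix.rank_mul_le_left _ _).trans ((Matrix.rank_le_card_width _).trans (by simp))

theorem rank_le_rank_conjTranspose {F ρ₁ ρ₂ : Type} [Field F] [StarRing F] [Fintype ρ₁]
    [Fintype ρ₂] (A : Matrix ρ₁ ρ₂ F) : A.rank ≤ Aᴴ.rank := by
  have h : A = (Aᴴᵀ).map (starRingEnd F) := by
    ext i j
    exact (star_star (A i j)).symm
  calc A.rank = ((Aᴴᵀ).map (starRingEnd F)).rank := by rw [← h]
    _ ≤ (Aᴴᵀ).rank := rank_map_le _ _
    _ = Aᴴ.rank := Matrix.rank_transpose _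

/-- The columns are extended to a basis over the fraction field, and a common denominator of the
new columns is cleared, which leaves the given ones as they are. -/
theorem exists_nonsingular_completion {R : Type*} [CommRing R] [IsDomain R]
    (F : Type*) [Field F] [Algebra R F] [IsFractionRing R F] {ρ γ α : Type} [Fintype ρ]
    [DecidableEq ρ] [Fintype γ] [Fintype α] [DecidableEq γ] [DecidableEq α]
    (B : Matrix ρ γ R) (e : ρ ≃ γ ⊕ α) (hB : (B.map (algebraMap R F)).rank = Fintype.card γ) :
    ∃ P : Matrix ρ ρ R, P.det ≠ 0 ∧ ∀ r i, P r (e.symm (Sum.inl i)) = B r i := by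
  have hli : LinearIndependent F (B.map (algebraMap R F)).col := by
    rw [← Matrix.row_transpose]
    rw [linearIndependent_iff_card_eq_finrank_span, ← hB, ← Matrix.rank_transpose,
      Matrix.rank_eq_finrank_span_row]
    rfl
  let b := Module.Basis.sumExtend hli
  have : Finite (γ ⊕ Module.Basis.sumExtendIndex hli) := Module.Finite.finite_basis b
  have : Finite (Module.Basis.sumExtendIndex hli) :=
    Finite.of_injective (β := γ ⊕ Module.Basis.sumExtendIndex hli) _ Sum.inr_injective
  have : Fintype (Module.Basis.sumExtendIndex hli) := Fintype.ofFinite _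
  have hcard : Fintype.card (Module.Basis.sumExtendIndex hli) = Fintype.card α := by
    have h1 := Module.finrank_eq_card_basis b
    have h2 := Fintype.card_congr e
    rw [Module.finrank_fintype_fun_eq_card, Fintype.card_sum] at h1
    rw [Fintype.card_sum] at h2
    omega
  let ε := Fintype.equivOfCardEq hcard
  let b' : Module.Basis ρ F (ρ → F) :=
    b.reindex ((Equiv.sumCongr (Equiv.refl γ) ε).trans e.symm)
  have hb' : ∀ i r, b' (e.symm (Sum.inl i)) r = algebraMap R F (B r i) := fun i r => by
    simp only [b', b, Module.Basis.sumExtend]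
    simp only [Module.Basis.coe_reindex, Function.comp_apply, Equiv.symm_trans_apply,
      Equiv.symm_symm, Equiv.apply_symm_apply, Module.Basis.coe_extend]
    erw [Equiv.Set.sumDiffSubset_apply_inl]
    · rfl
    · exact hli.linearIndepOn_id.subset_extend _
  obtain ⟨d, hd⟩ := IsLocalization.exist_integer_multiples_of_finite (nonZeroDivisors R)
    (fun x : ρ × ρ => b' x.1 x.2)
  choose q hq using hd
  have hd0 : algebraMap R F d ≠ 0 := by simp
  let s : ρ → F := fun x => Sum.elim (fun _ => 1) (fun _ => algebraMap R F d) (e x)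
  let P : Matrix ρ ρ R := Matrix.of fun r x => Sum.elim (fun i => B r i) (fun _ => q (x, r)) (e x)
  refine ⟨P, ?_, fun r i => by simp [P]⟩
  have hP : P.map (algebraMap R F) = (Pi.basisFun F ρ).toMatrix b' * Matrix.diagonal s := by
    ext r x
    rw [Matrix.mul_diagonal, Module.Basis.toMatrix_apply]
    obtain ⟨x, rfl⟩ := e.symm.surjective x
    rcases x with x | x
    · simp [P, s, hb']
    · simp only [map_apply, of_apply, Equiv.apply_symm_apply, Sum.elim_inr, Pi.basisFun_repr, P, s]
      rw [hq, mul_comm]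
      simp [Algebra.smul_def]
  intro h0
  have h1 : (P.map (algebraMap R F)).det = 0 := by
    rw [← RingHom.mapMatrix_apply, ← RingHom.map_det, h0, map_zero]
  rw [hP, Matrix.det_mul, Matrix.det_diagonal, mul_eq_zero] at h1
  rcases h1 with h1 | h1
  · have : IsUnit ((Pi.basisFun F ρ).toMatrix b') :=
      (IsUnit.of_mul_eq_one _ (Module.Basis.toMatrix_mul_toMatrix_flip (Pi.basisFun F ρ) b'))
    exact ((Matrix.isUnit_iff_isUnit_det _).1 this).ne_zero h1
  · obtain ⟨x, -, hx⟩ := Finset.prod_eq_zero_iff.1 h1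
    revert hx
    dsimp only [s]
    rcases e x with y | y <;> simp [hd0]


/-- Symplectic completion in CSS form. The pairs `Ze, Xe` (ebits) and the stabilizer rows `Za`, `Xa`
(ancillas) are completed by the logical operators `a + b * Ze`, `a' + b' * Xe` read off from
operators `(b | a)`, `(b' | a')` that commute with the extended stabilizer, and by partners of
`Za` and `Xa`, to a pair of dual bases. -/
theorem exists_dual_completion {F γ α₁ α₂ κ N : Type} [Field F] [StarRing F] [CharP F 2]
    [Fintype γ] [Fintype α₁] [Fintype α₂] [Fintype κ] [Fintype N]
    [DecidableEq γ] [DecidableEq α₁] [DecidableEq α₂] [DecidableEq κ]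
    {Ze Xe : Matrix γ N F} {Za : Matrix α₁ N F} {Xa : Matrix α₂ N F}
    {a a' : Matrix κ N F} {b b' : Matrix κ γ F}
    (hee : Ze * Xeᴴ = 1) (hea : Ze * Xaᴴ = 0) (hae : Za * Xeᴴ = 0) (haa : Za * Xaᴴ = 0)
    (hZa : ∃ Y : Matrix N α₁ F, Za * Y = 1) (hXa : ∃ Y : Matrix N α₂ F, Xa * Y = 1)
    (hb : a * Xeᴴ = b) (ha : a * Xaᴴ = 0) (hb' : Ze * a'ᴴ = b'ᴴ) (ha' : Za * a'ᴴ = 0)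
    (hab : a * a'ᴴ + b * b'ᴴ = 1) :
    ∃ V Vd : Matrix (γ ⊕ (α₁ ⊕ α₂) ⊕ κ) N F, V * Vdᴴ = 1 ∧
      (∀ i, V (Sum.inl i) = Ze i) ∧ (∀ i, Vd (Sum.inl i) = Xe i) ∧
      (∀ i, V (Sum.inr (Sum.inl (Sum.inl i))) = Za i) ∧
      (∀ i, Vd (Sum.inr (Sum.inl (Sum.inr i))) = Xa i) ∧
      (∀ i, V (Sum.inr (Sum.inr i)) = (a + b * Ze) i) ∧
      (∀ i, Vd (Sum.inr (Sum.inr i)) = (a' + b' * Xe) i) := by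
  have dbl : ∀ {μ ν : Type} (A : Matrix μ ν F), A + A = 0 := fun A => by
    ext i j; exact CharTwo.add_self_eq_zero _
  obtain ⟨Y, hY⟩ := hZa
  obtain ⟨Y', hY'⟩ := hXa
  set L := a + b * Ze with hL
  set L' := a' + b' * Xe with hL'
  have hLe : L * Xeᴴ = 0 := by
    rw [hL, Matrix.add_mul, Matrix.mul_assoc, hee, hb, Matrix.mul_one, dbl]
  have hLa : L * Xaᴴ = 0 := by
    rw [hL, Matrix.add_mul, Matrix.mul_assoc, hea, ha, Matrix.mul_zero, add_zero]
  have hL'H : L'ᴴ = a'ᴴ + Xeᴴ * b'ᴴ := by simp [hL']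
  have heL : Ze * L'ᴴ = 0 := by
    rw [hL'H, Matrix.mul_add, ← Matrix.mul_assoc, hee, hb', Matrix.one_mul, dbl]
  have haL : Za * L'ᴴ = 0 := by
    rw [hL'H, Matrix.mul_add, ← Matrix.mul_assoc, hae, ha', Matrix.zero_mul, add_zero]
  have hLL : L * L'ᴴ = 1 := by
    rw [hL, Matrix.add_mul, Matrix.mul_assoc, heL, Matrix.mul_zero, add_zero, hL'H, Matrix.mul_add,
      ← Matrix.mul_assoc, hb, hab]
  -- a right inverse of `Za` orthogonal to the ebit and logical rows of the first basis
  let U : Matrix N α₁ F := Y - Xeᴴ * (Ze * Y) - L'ᴴ * (L * Y)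
  have hU1 : Za * U = 1 := by
    simp only [U, Matrix.mul_sub, ← Matrix.mul_assoc, hae, haL, hY]; simp
  have hU2 : Ze * U = 0 := by
    simp only [U, Matrix.mul_sub, ← Matrix.mul_assoc, hee, heL]; simp
  have hU3 : L * U = 0 := by
    simp only [U, Matrix.mul_sub, ← Matrix.mul_assoc, hLe, hLL]; simp
  -- partners of `Xa`, orthogonal to the second basis
  let W₀ : Matrix α₂ N F := Y'ᴴ - (Y'ᴴ * Xeᴴ) * Ze - (Y'ᴴ * L'ᴴ) * L
  let W : Matrix α₂ N F := W₀ - (W₀ * U) * Za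
  have hY'H : Y'ᴴ * Xaᴴ = 1 := by
    rw [← Matrix.conjTranspose_mul, hY', Matrix.conjTranspose_one]
  have hW1 : W * Xaᴴ = 1 := by
    simp only [W, W₀, Matrix.sub_mul, Matrix.mul_assoc, hea, hLa, haa, hY'H]; simp
  have hW2 : W * Xeᴴ = 0 := by
    simp only [W, W₀, Matrix.sub_mul, Matrix.mul_assoc, hee, hLe, hae]; simp
  have hW3 : W * L'ᴴ = 0 := by
    simp only [W, W₀, Matrix.sub_mul, Matrix.mul_assoc, heL, hLL, haL]; simp
  have hW4 : W * U = 0 := by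
    simp only [W, Matrix.sub_mul, Matrix.mul_assoc, hU1]; simp
  refine ⟨Matrix.fromRows Ze (Matrix.fromRows (Matrix.fromRows Za W) L),
    Matrix.fromRows Xe (Matrix.fromRows (Matrix.fromRows Uᴴ Xa) L'), ?_, fun _ => rfl, fun _ => rfl,
    fun _ => rfl, fun _ => rfl, fun _ => rfl, fun _ => rfl⟩
  simp only [Matrix.conjTranspose_fromRows_eq_fromCols_conjTranspose,
    Matrix.conjTranspose_conjTranspose, Matrix.fromRows_mul, Matrix.mul_fromCols, hee, hea, hae, haa,
    hU1, hU2, hU3, hW1, hW2, hW3, hW4, hLe, hLa, heL, haL, hLL]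
  ext i j
  rcases i with i | (i | i) | i <;> rcases j with j | (j | j) | j <;> simp [Matrix.one_apply]

/-! ### Time reversal as a star operation -/

/-- Time reversal `f(D) ↦ f(D⁻¹)` of Laurent polynomials, as a star operation: `Aᴴ` is `Aᵀ(D⁻¹)`. -/
instance : StarRing Lau where
  star := LaurentPolynomial.invert
  star_involutive := LaurentPolynomial.involutive_invert
  star_mul _ _ := by rw [map_mul, mul_comm]
  star_add := map_add _

theorem star_lau (f : Lau) : star f = LaurentPolynomial.invert f := rfl

theorem timeRev_algebraMap (f : Lau) :
    timeRev (algebraMap Lau Rat2 f) = algebraMap Lau Rat2 (star f) :=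
  IsFractionRing.ringEquivOfRingEquiv_algebraMap _ f

/-- Time reversal of rational functions, as a star operation. -/
instance : StarRing Rat2 where
  star := timeRev
  star_involutive x := by
    obtain ⟨p, q, -, rfl⟩ := IsFractionRing.div_surjective (A := Lau) x
    simp only [map_div₀, timeRev_algebraMap, star_star]
  star_mul _ _ := by rw [map_mul, mul_comm]
  star_add := map_add _

theorem star_algebraMap (f : Lau) :
    star (algebraMap Lau Rat2 f) = algebraMap Lau Rat2 (star f) := timeRev_algebraMap f

instance : CharP Lau 2 :=
  charP_of_injective_algebraMap (FaithfulSMul.algebraMap_injective (ZMod 2) Lau) 2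

instance : CharP Rat2 2 := charP_of_injective_algebraMap (IsFractionRing.injective Lau Rat2) 2

instance : IsPrincipalIdealRing Lau where
  principal I := by
    obtain ⟨g, hg⟩ := IsPrincipalIdealRing.principal (I.under (Polynomial (ZMod 2)))
    refine ⟨algebraMap _ Lau g, ?_⟩
    rw [← IsLocalization.map_under (Submonoid.powers (Polynomial.X : Polynomial (ZMod 2))) Lau I,
      hg]
    exact (Ideal.map_span _ _).trans (by rw [Set.image_singleton])

theorem toRat_mul {ρ κ μ : Type} [Fintype κ] (A : Matrix ρ κ Lau) (B : Matrix κ μ Lau) :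
    toRat (A * B) = toRat A * toRat B := Matrix.map_mul

theorem toRat_one {κ : Type} [DecidableEq κ] : toRat (1 : Matrix κ κ Lau) = 1 :=
  Matrix.map_one _ (map_zero _) (map_one _)

theorem toRat_conjTranspose {ρ κ : Type} (A : Matrix ρ κ Lau) : toRat Aᴴ = (toRat A)ᴴ := by
  ext i j
  exact (star_algebraMap _).symm

theorem toRat_transvection {κ : Type} [DecidableEq κ] (i j : κ) (f : Lau) :
    toRat (transvection i j f) = transvection i j (algebraMap Lau Rat2 f) := by
  rw [transvection, toRat, Matrix.map_add _ (map_add _), Matrix.map_one _ (map_zero _) (map_one _),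
    Matrix.map_single]
  rfl

theorem exists_polynomial_multiple {κ : Type} [Finite κ] (v : κ → Lau) :
    ∃ (n : ℤ) (p : κ → Polynomial (ZMod 2)), ∀ x, Polynomial.toLaurent (p x) =
      v x * LaurentPolynomial.T n := by
  have := Fintype.ofFinite κ
  choose n p hp using fun x => (v x).exists_T_pow
  refine ⟨(∑ x, n x : ℕ), fun x => p x * Polynomial.X ^ (∑ y, n y - n x), fun x => ?_⟩
  have h : n x ≤ ∑ y, n y := Finset.single_le_sum (fun _ _ => Nat.zero_le _) (Finset.mem_univ x)
  rw [map_mul, hp, Polynomial.toLaurent_X_pow, LaurentPolynomial.mul_T_assoc, Nat.cast_sub h]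
  congr 2
  ring

/-! ### Column operations by finite-depth CNOT gates -/

theorem conjTranspose_transvection {κ R : Type} [DecidableEq κ] [CommRing R] [StarRing R]
    (i j : κ) (f : R) : (transvection i j f)ᴴ = transvection j i (star f) := by
  simp [transvection]

section Shears
variable {κ : Type} [Fintype κ] [DecidableEq κ]

theorem vecMul_transvection {R : Type} [CommRing R] (v : κ → R) (i j x : κ) (f : R) :
    (v ᵥ* transvection i j f) x = v x + if x = j then v i * f else 0 := by
  rw [transvection, Matrix.vecMul_add, Matrix.vecMul_one, Pi.add_apply]
  congr 1
  by_cases h : x = j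
  · simp [Matrix.vecMul, dotProduct, Matrix.single_apply, h]
  · simp [Matrix.vecMul, dotProduct, h, Ne.symm h]

/-- The pairs `(W, W')` of the column operations performed on the "Z" and on the "X" side by circuits
of finite-depth CNOT gates on the qubits in `S`. Here `W'` is the inverse of `Wᴴ`, by
`mul_conjTranspose_of_mem_shears`. -/
def shears (S : Set κ) : Submonoid (Matrix κ κ Lau × Matrix κ κ Lau) :=
  Submonoid.closure {w | ∃ i ∈ S, ∃ j ∈ S, i ≠ j ∧ ∃ f : Lau,
    w = (transvection i j f, transvection j i (star f))}

theorem transvection_mem_shears {S : Set κ} {i j : κ} (hi : i ∈ S) (hj : j ∈ S) (hij : i ≠ j)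
    (f : Lau) : (transvection i j f, transvection j i (star f)) ∈ shears S :=
  Submonoid.subset_closure ⟨i, hi, j, hj, hij, f, rfl⟩

theorem shears_mono {S S' : Set κ} (h : S ⊆ S') : shears S ≤ shears S' :=
  Submonoid.closure_mono fun _ ⟨i, hi, j, hj, hij, f, hw⟩ => ⟨i, h hi, j, h hj, hij, f, hw⟩

theorem mul_conjTranspose_of_mem_shears {S : Set κ} {w : Matrix κ κ Lau × Matrix κ κ Lau}
    (hw : w ∈ shears S) : w.1 * w.2ᴴ = 1 := by
  induction hw using Submonoid.closure_induction with
  | mem w h =>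
    obtain ⟨i, -, j, -, hij, f, rfl⟩ := h
    rw [conjTranspose_transvection, star_star, transvection_mul_transvection_same _ _ hij,
      CharTwo.add_self_eq_zero, transvection_zero]
  | one => simp
  | mul v w _ _ hv hw =>
    rw [Prod.fst_mul, Prod.snd_mul, Matrix.conjTranspose_mul, Matrix.mul_assoc,
      ← Matrix.mul_assoc w.1, hw, Matrix.one_mul, hv]

theorem swap_mem_shears {S : Set κ} {w : Matrix κ κ Lau × Matrix κ κ Lau}
    (hw : w ∈ shears S) : w.swap ∈ shears S := by
  induction hw using Submonoid.closure_induction with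
  | mem w h =>
    obtain ⟨i, hi, j, hj, hij, f, rfl⟩ := h
    have := transvection_mem_shears hj hi hij.symm (star f)
    rwa [star_star] at this
  | one => exact one_mem _
  | mul v w _ _ hv hw =>
    rw [Prod.swap_mul]
    exact mul_mem hv hw

theorem vecMul_eq_self_of_mem_shears {S : Set κ} {w : Matrix κ κ Lau × Matrix κ κ Lau}
    (hw : w ∈ shears S) {v : κ → Lau} (hv : ∀ j ∈ S, v j = 0) : v ᵥ* w.1 = v := by
  induction hw using Submonoid.closure_induction with
  | mem w h =>
    obtain ⟨i, hi, j, hj, hij, f, rfl⟩ := h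
    ext x
    simp [vecMul_transvection, hv i hi]
  | one => simp
  | mul v w _ _ hv hw => rw [Prod.fst_mul, ← Matrix.vecMul_vecMul, hv, hw]

/-- The Euclidean algorithm on the entries of a row of polynomials. -/
theorem exists_shears_poly_row (S : Finset κ) {j₀ : κ} (hj₀ : j₀ ∈ S)
    (p : κ → Polynomial (ZMod 2)) :
    ∃ w ∈ shears (S : Set κ), ∀ j ∈ S, j ≠ j₀ →
      ((fun x => Polynomial.toLaurent (p x)) ᵥ* w.1) j = 0 := by
  obtain ⟨m, hm⟩ : ∃ m, ∑ x ∈ S, (if p x = 0 then 0 else (p x).natDegree + 1) = m := ⟨_, rfl⟩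
  induction m using Nat.strong_induction_on generalizing p with
  | _ m ih =>
  by_cases h : ∃ i ∈ S, ∃ j ∈ S, i ≠ j ∧ p i ≠ 0 ∧ p j ≠ 0 ∧ (p i).natDegree ≤ (p j).natDegree
  · obtain ⟨i, hi, j, hj, hij, hpi, hpj, hd⟩ := h
    let q := Function.update p j (p j % p i)
    have hlt : ∑ x ∈ S, (if q x = 0 then 0 else (q x).natDegree + 1) < m := by
      rw [← hm]
      have hqj : (if q j = 0 then 0 else (q j).natDegree + 1) < (p j).natDegree + 1 := by
        split_ifs with h0
        · omega
        · have : (q j).natDegree < (p i).natDegree := by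
            apply Polynomial.natDegree_lt_natDegree h0
            simp only [q, Function.update_self]
            exact EuclideanDomain.mod_lt _ hpi
          omega
      refine Finset.sum_lt_sum (fun x _ => ?_) ⟨j, hj, ?_⟩
      · by_cases hx : x = j
        · subst hx; rw [if_neg hpj]; exact hqj.le
        · simp [q, hx]
      · rw [if_neg hpj]; exact hqj
    obtain ⟨w, hw, hw0⟩ := ih _ hlt q rfl
    refine ⟨_, mul_mem (transvection_mem_shears hi hj hij (-Polynomial.toLaurent (p j / p i))) hw,
      fun x hx hx0 => ?_⟩
    rw [← hw0 x hx hx0, Prod.fst_mul, ← Matrix.vecMul_vecMul]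
    congr 2
    ext1 y
    rw [vecMul_transvection]
    by_cases hy : y = j
    · subst hy
      simp only [q, Function.update_self, if_true, EuclideanDomain.mod_eq_sub_mul_div, map_sub,
        map_mul]
      ring
    · simp [q, hy]
  · push Not at h
    by_cases h1 : ∃ i ∈ S, i ≠ j₀ ∧ p i ≠ 0
    · obtain ⟨i, hi, hij, hpi⟩ := h1
      have h0 : ∀ j ∈ S, j ≠ i → p j = 0 := fun j hj hji => by
        by_contra hpj
        exact absurd (h i hi j hj hji.symm hpi hpj) (not_lt.2 (h j hj i hi hji hpj hpi).le)
      refine ⟨_, mul_mem (transvection_mem_shears hi hj₀ hij 1)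
        (transvection_mem_shears hj₀ hi hij.symm 1), fun x hx hx0 => ?_⟩
      rw [Prod.fst_mul, ← Matrix.vecMul_vecMul, vecMul_transvection, vecMul_transvection,
        vecMul_transvection, if_neg hx0]
      by_cases hxi : x = i
      · subst hxi
        simp [h0 j₀ hj₀ hij.symm, CharTwo.add_self_eq_zero]
      · simp [hxi, h0 x hx hxi]
    · push Not at h1
      exact ⟨1, one_mem _, fun x hx hx0 => by simp [h1 x hx hx0]⟩

theorem exists_shears_row (S : Finset κ) {j₀ : κ} (hj₀ : j₀ ∈ S) (v : κ → Lau) :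
    ∃ w ∈ shears (S : Set κ), ∀ j ∈ S, j ≠ j₀ → (v ᵥ* w.1) j = 0 := by
  obtain ⟨n, p, hp⟩ := exists_polynomial_multiple v
  obtain ⟨w, hw, h⟩ := exists_shears_poly_row S hj₀ p
  refine ⟨w, hw, fun j hj hj0 => ?_⟩
  have h1 : (fun x => Polynomial.toLaurent (p x)) = (LaurentPolynomial.T n : Lau) • v := by
    ext1 x
    rw [hp, Pi.smul_apply, smul_eq_mul, mul_comm]
  have h2 := h j hj hj0
  rw [h1, Matrix.smul_vecMul, Pi.smul_apply, smul_eq_mul] at h2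
  exact ((LaurentPolynomial.isUnit_T n).mul_right_eq_zero).1 h2

theorem exists_shears_fin {r : ℕ} (A : Matrix (Fin r) κ Lau) (S T : Finset κ) (hT : T ⊆ S)
    (hr : T.card = r) :
    ∃ w ∈ shears (S : Set κ), ∀ i, ∀ j ∈ S, j ∉ T → (A * w.1) i j = 0 := by
  induction r generalizing S T with
  | zero => exact ⟨1, one_mem _, fun i => i.elim0⟩
  | succ r ih =>
    obtain ⟨j₀, hj₀⟩ : T.Nonempty := by rw [← Finset.card_pos]; omega
    obtain ⟨w, hw, h⟩ := exists_shears_row S (hT hj₀) (A 0)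
    obtain ⟨w', hw', h'⟩ := ih ((A * w.1).submatrix Fin.succ id) (S.erase j₀) (T.erase j₀)
      (Finset.erase_subset_erase _ hT) (by rw [Finset.card_erase_of_mem hj₀, hr]; rfl)
    refine ⟨_, mul_mem hw (shears_mono (by simp) hw'), fun i j hj hjT => ?_⟩
    have hne : j ≠ j₀ := fun h => hjT (h ▸ hj₀)
    rw [Prod.fst_mul, ← Matrix.mul_assoc]
    refine Fin.cases ?_ (fun i => ?_) i
    · rw [Matrix.mul_apply_eq_vecMul, vecMul_eq_self_of_mem_shears hw' fun j hj => ?_]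
      · rw [Matrix.mul_apply_eq_vecMul]
        exact h j hj hne
      · rw [Matrix.mul_apply_eq_vecMul]
        exact h j (Finset.mem_of_mem_erase hj) (Finset.ne_of_mem_erase hj)
    · exact h' i j (Finset.mem_erase.2 ⟨hne, hj⟩) fun h => hjT (Finset.mem_of_mem_erase h)

/-- Column echelon reduction: column operations on the columns in `S` clear all of them but as many
as there are rows. -/
theorem exists_shears {ρ : Type} [Fintype ρ] (A : Matrix ρ κ Lau) (S T : Finset κ) (hT : T ⊆ S)
    (hr : T.card = Fintype.card ρ) :
    ∃ w ∈ shears (S : Set κ), ∀ i, ∀ j ∈ S, j ∉ T → (A * w.1) i j = 0 := by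
  obtain ⟨w, hw, h⟩ := exists_shears_fin (A.submatrix (Fintype.equivFin ρ).symm id) S T hT hr
  refine ⟨w, hw, fun i j hj hjT => ?_⟩
  obtain ⟨i, rfl⟩ := (Fintype.equivFin ρ).symm.surjective i
  exact h i j hj hjT

/-- Two orthogonal sets of independent generators, of "Z" type and of "X" type, are moved off a
prescribed set of qubits by a finite-depth CNOT circuit. The first reduction brings `A` to a
nonsingular square block, so by orthogonality `B` vanishes on its columns, and the second reduction
is confined to the other columns. -/
theorem exists_shears_pair {ρ₁ ρ₂ : Type} [Fintype ρ₁] [DecidableEq ρ₁] [Fintype ρ₂]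
    (A : Matrix ρ₁ κ Lau) (B : Matrix ρ₂ κ Lau) (hAB : A * Bᴴ = 0)
    (hA : ∃ N : Matrix κ ρ₁ Rat2, toRat A * N = 1) (I : Finset κ)
    (hI : Fintype.card ρ₁ + Fintype.card ρ₂ + I.card = Fintype.card κ) :
    ∃ w ∈ shears (Set.univ : Set κ), (∀ r, ∀ j ∈ I, (A * w.1) r j = 0) ∧
      ∀ r, ∀ j ∈ I, (B * w.2) r j = 0 := by
  have hIc : Iᶜ.card = Fintype.card ρ₁ + Fintype.card ρ₂ := by
    rw [Finset.card_compl]; omega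
  obtain ⟨T₁, hT₁, hc₁⟩ := Finset.exists_subset_card_eq (s := Iᶜ) (n := Fintype.card ρ₁) (by omega)
  have hc₂ : (Iᶜ \ T₁).card = Fintype.card ρ₂ := by
    rw [Finset.card_sdiff_of_subset hT₁]; omega
  obtain ⟨w, hw, h⟩ := exists_shears A Finset.univ T₁ (Finset.subset_univ _) hc₁
  rw [Finset.coe_univ] at hw
  have hw1 := mul_conjTranspose_of_mem_shears hw
  -- `B` vanishes on the columns in `T₁`
  have hB : ∀ r, ∀ j ∈ T₁, (B * w.2) r j = 0 := by
    obtain ⟨N, hN⟩ := hA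
    let A' : Matrix ρ₁ T₁ Rat2 := (toRat (A * w.1)).submatrix id Subtype.val
    let N' : Matrix T₁ ρ₁ Rat2 := ((toRat w.2ᴴ) * N).submatrix Subtype.val id
    let B' : Matrix T₁ ρ₂ Rat2 := (toRat (B * w.2)ᴴ).submatrix Subtype.val id
    have hres : ∀ {μ : Type} (X : Matrix κ μ Rat2),
        A' * (X.submatrix Subtype.val id : Matrix T₁ μ Rat2) = toRat (A * w.1) * X := fun X => by
      ext r j
      simp only [Matrix.mul_apply, A', Matrix.submatrix_apply, id]
      rw [Finset.sum_coe_sort T₁ (fun x => toRat (A * w.1) r x * X x j)]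
      refine Finset.sum_subset (Finset.subset_univ _) fun x _ hx => ?_
      simp [toRat, h r x (Finset.mem_univ _) hx]
    have h1 : A' * N' = 1 := by
      rw [hres, ← Matrix.mul_assoc, ← toRat_mul, Matrix.mul_assoc A, hw1, Matrix.mul_one, hN]
    have h2 : N' * A' = 1 := (Matrix.mul_eq_one_comm_of_card_eq _ _ _ (by simp [hc₁])).1 h1
    have h3 : A' * B' = 0 := by
      rw [hres, ← toRat_mul, Matrix.conjTranspose_mul, Matrix.mul_assoc, ← Matrix.mul_assoc w.1,
        hw1, Matrix.one_mul, hAB]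
      ext; simp [toRat]
    have h4 : B' = 0 := by
      rw [← Matrix.one_mul B', ← h2, Matrix.mul_assoc, h3, Matrix.mul_zero]
    intro r j hj
    have h5 : algebraMap Lau Rat2 (star ((B * w.2) r j)) = 0 := congrFun (congrFun h4 ⟨j, hj⟩) r
    rwa [map_eq_zero_iff _ (IsFractionRing.injective Lau Rat2), star_eq_zero] at h5
  obtain ⟨w', hw', h'⟩ := exists_shears (B * w.2) T₁ᶜ (Iᶜ \ T₁)
    (fun x hx => by simp only [Finset.mem_sdiff, Finset.mem_compl] at hx ⊢; exact hx.2) hc₂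
  have hIT : ∀ j ∈ I, j ∉ T₁ := fun j hj hjT => by simpa [hj] using hT₁ hjT
  refine ⟨w * w'.swap, mul_mem hw (shears_mono (Set.subset_univ _) (swap_mem_shears hw')),
    fun r j hj => ?_, fun r j hj => ?_⟩
  · rw [Prod.fst_mul, ← Matrix.mul_assoc, Matrix.mul_apply_eq_vecMul,
      vecMul_eq_self_of_mem_shears (swap_mem_shears hw') fun x hx => ?_]
    · exact h r j (Finset.mem_univ _) (hIT j hj)
    · exact h r x (Finset.mem_univ _) (by simpa using hx)
  · rw [Prod.snd_mul, ← Matrix.mul_assoc]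
    exact h' r j (by simpa using hIT j hj) (by simp [hj])

end Shears

/-! ### Circuits -/

theorem blockDiag_mul {R ρ σ κ μ ν τ : Type} [CommRing R] [Fintype κ] [Fintype μ] (A : Matrix ρ κ R)
    (B : Matrix σ μ R) (A' : Matrix κ ν R) (B' : Matrix μ τ R) :
    fromBlocks A 0 0 B * fromBlocks A' 0 0 B' = fromBlocks (A * A') 0 0 (B * B') := by
  simp [fromBlocks_multiply]

theorem toRat_blockDiag {ρ σ κ μ : Type} (A : Matrix ρ κ Lau) (B : Matrix σ μ Lau) :
    toRat (fromBlocks A 0 0 B) = fromBlocks (toRat A) 0 0 (toRat B) := by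
  simp [toRat, fromBlocks_map]

section Circuits
variable {Q : Type} [DecidableEq Q]

theorem mat_cnot (i j : Q) (h : i ≠ j) (l : ℤ) :
    (FinGate.cnot i j h l).mat =
      fromBlocks (transvection j i (delayPow (-l))) 0 0 (transvection i j (delayPow l)) := by
  ext a b
  rcases a with a | a <;> rcases b with b | b <;>
    simp [FinGate.mat, transvection, Matrix.one_apply, Matrix.single_apply]

theorem conjTranspose_diagonal_update (i : Q) (x : Rat2) :
    (diagonal (Function.update (1 : Q → Rat2) i x))ᴴ = diagonal (Function.update 1 i (star x)) := by
  rw [diagonal_conjTranspose]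
  congr 1
  ext q
  by_cases h : q = i
  · subst h; simp
  · simp [h]

theorem mat_inf (i : Q) (f : Lau) (hf : f ≠ 0) : (Gate.inf i f hf).mat =
    fromBlocks (diagonal (Function.update 1 i (algebraMap Lau Rat2 (star f)))) 0 0
      (diagonal (Function.update 1 i (algebraMap Lau Rat2 f)⁻¹)) := by
  rw [fromBlocks_diagonal, Gate.mat, timeRev_algebraMap]
  congr 1
  ext q
  rcases q with q | q <;> simp [Function.update_apply]

variable [Fintype Q]

theorem finCircuitMat_append (gs hs : List (FinGate Q)) :
    finCircuitMat (gs ++ hs) = finCircuitMat gs * finCircuitMat hs := by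
  simp [finCircuitMat]

theorem circuitMat_append (gs hs : List (Gate Q)) :
    circuitMat (gs ++ hs) = circuitMat gs * circuitMat hs := by
  simp [circuitMat]

theorem circuitMat_map_fin (gs : List (FinGate Q)) :
    circuitMat (gs.map Gate.fin) = finCircuitMat gs := by
  rw [circuitMat, finCircuitMat, List.map_map]
  rfl

theorem exists_finCircuit_transvection {i j : Q} (hij : i ≠ j) (f : Lau) :
    ∃ gs : List (FinGate Q), finCircuitMat gs =
      fromBlocks (toRat (transvection i j f)) 0 0 (toRat (transvection j i (star f))) := by
  induction f using LaurentPolynomial.induction_on' with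
  | add p q hp hq =>
    obtain ⟨gs, hg⟩ := hp
    obtain ⟨hs, hh⟩ := hq
    refine ⟨gs ++ hs, ?_⟩
    rw [finCircuitMat_append, hg, hh, blockDiag_mul, ← toRat_mul, ← toRat_mul,
      transvection_mul_transvection_same _ _ hij, transvection_mul_transvection_same _ _ hij.symm,
      star_add]
  | C_mul_T n a =>
    obtain rfl | rfl : a = 0 ∨ a = 1 := by revert a; decide
    · refine ⟨[], ?_⟩
      simp [finCircuitMat, toRat_one]
    · refine ⟨[.cnot j i hij.symm (-n)], ?_⟩
      simp only [finCircuitMat, List.map_cons, List.map_nil, List.prod_cons, List.prod_nil,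
        mul_one, mat_cnot, toRat_transvection, map_one, one_mul, star_lau,
        LaurentPolynomial.invert_T, neg_neg, delayPow]

theorem exists_finCircuit_of_mem_shears {S : Set Q} {w : Matrix Q Q Lau × Matrix Q Q Lau}
    (hw : w ∈ shears S) :
    ∃ gs : List (FinGate Q), finCircuitMat gs = fromBlocks (toRat w.1) 0 0 (toRat w.2) := by
  induction hw using Submonoid.closure_induction with
  | mem w h =>
    obtain ⟨i, -, j, -, hij, f, rfl⟩ := h
    exact exists_finCircuit_transvection hij f
  | one => exact ⟨[], by simp [finCircuitMat, toRat_one]⟩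
  | mul v w _ _ hv hw =>
    obtain ⟨gs, hg⟩ := hv
    obtain ⟨hs, hh⟩ := hw
    exact ⟨gs ++ hs, by rw [finCircuitMat_append, hg, hh, blockDiag_mul, ← toRat_mul, ← toRat_mul,
      Prod.fst_mul, Prod.snd_mul]⟩

/-- A set of Hadamard gates exchanges the "Z" and the "X" rows of the qubits that it acts on. -/
theorem exists_hadamards (s : Finset Q) :
    ∃ gs : List (Gate Q), ∀ (E : Matrix (Q ⊕ Q) (Q ⊕ Q) Rat2) (q : Q),
      (circuitMat gs * E) (Sum.inl q) = (if q ∈ s then E (Sum.inr q) else E (Sum.inl q)) ∧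
      (circuitMat gs * E) (Sum.inr q) = (if q ∈ s then E (Sum.inl q) else E (Sum.inr q)) := by
  induction s using Finset.induction_on with
  | empty => exact ⟨[], fun E q => by simp [circuitMat]⟩
  | insert a s ha ih =>
    obtain ⟨gs, h⟩ := ih
    refine ⟨gs ++ [.fin (.hadamard a)], fun E q => ?_⟩
    have hE : circuitMat [.fin (.hadamard a)] * E =
        E.submatrix (Equiv.swap (Sum.inl a) (Sum.inr a)) id := by
      simp only [circuitMat, List.map_cons, List.map_nil, List.prod_cons, List.prod_nil, mul_one,
        Gate.mat, FinGate.mat]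
      exact PEquiv.toMatrix_toPEquiv_mul _ _
    rw [circuitMat_append, Matrix.mul_assoc, hE]
    obtain ⟨h1, h2⟩ := h (E.submatrix (Equiv.swap (Sum.inl a) (Sum.inr a)) id) q
    rw [h1, h2]
    have hsub : ∀ x, (E.submatrix (Equiv.swap (Sum.inl a) (Sum.inr a)) id) x =
      E (Equiv.swap (Sum.inl a) (Sum.inr a) x) := fun _ => rfl
    rw [hsub, hsub]
    by_cases hq : q = a
    · subst hq
      simp [ha]
    · rw [Equiv.swap_apply_of_ne_of_ne (fun h => hq (Sum.inl_injective h)) (by simp),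
        Equiv.swap_apply_of_ne_of_ne (by simp) fun h => hq (Sum.inr_injective h)]
      simp [hq]

/-- Some encoding circuit multiplies the "Z" side by `V`, and the "X" side by the inverse of `Vᴴ`. -/
def Encodes (V : Matrix Q Q Rat2) : Prop :=
  ∃ gs : List (Gate Q), circuitMat gs = fromBlocks V 0 0 (V⁻¹)ᴴ

theorem Encodes.mul {V W : Matrix Q Q Rat2} (hV : Encodes V) (hW : Encodes W) :
    Encodes (V * W) := by
  obtain ⟨gs, hg⟩ := hV
  obtain ⟨hs, hh⟩ := hW
  exact ⟨gs ++ hs, by rw [circuitMat_append, hg, hh, blockDiag_mul, Matrix.mul_inv_rev,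
    Matrix.conjTranspose_mul]⟩

theorem inv_diagonal_update (i : Q) {x : Rat2} (hx : x ≠ 0) :
    (diagonal (Function.update (1 : Q → Rat2) i x))⁻¹ = diagonal (Function.update 1 i x⁻¹) := by
  apply Matrix.inv_eq_right_inv
  rw [diagonal_mul_diagonal, ← diagonal_one]
  congr 1
  ext q
  by_cases h : q = i
  · subst h; simp [hx]
  · simp [h]

theorem encodes_diagonal_algebraMap (i : Q) {f : Lau} (hf : f ≠ 0) :
    Encodes (diagonal (Function.update 1 i (algebraMap Lau Rat2 f))) := by
  have hf' : algebraMap Lau Rat2 f ≠ 0 := by simpa using hf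
  refine ⟨[.inf i (star f) (by simpa using hf)], ?_⟩
  simp only [circuitMat, List.map_cons, List.map_nil, List.prod_cons, List.prod_nil, mul_one,
    mat_inf, star_star, inv_diagonal_update i hf', conjTranspose_diagonal_update, star_inv₀,
    star_algebraMap]

/-- Conjugation by a Hadamard gate exchanges the effects of `1/f(D)` on the two sides. -/
theorem encodes_diagonal_inv (i : Q) {f : Lau} (hf : f ≠ 0) :
    Encodes (diagonal (Function.update 1 i (algebraMap Lau Rat2 f)⁻¹)) := by
  have hf' : (algebraMap Lau Rat2 f)⁻¹ ≠ 0 := by simpa using hf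
  refine ⟨[.fin (.hadamard i), .inf i f hf, .fin (.hadamard i)], ?_⟩
  simp only [circuitMat, List.map_cons, List.map_nil, List.prod_cons, List.prod_nil, mul_one,
    mat_inf, inv_diagonal_update i hf', conjTranspose_diagonal_update, inv_inv, star_algebraMap]
  rw [fromBlocks_diagonal, fromBlocks_diagonal]
  simp only [Gate.mat, FinGate.mat, Equiv.Perm.permMatrix]
  rw [PEquiv.mul_toMatrix_toPEquiv, PEquiv.toMatrix_toPEquiv_mul]
  rw [Equiv.symm_swap, submatrix_submatrix, Function.id_comp, Function.comp_id,
    submatrix_diagonal_equiv]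
  congr 1
  ext q
  by_cases hq : q = Sum.inl i ∨ q = Sum.inr i
  · rcases hq with rfl | rfl <;> simp
  · push Not at hq
    rw [Function.comp_apply, Equiv.swap_apply_of_ne_of_ne hq.1 hq.2]
    rcases q with q | q
    · have h : q ≠ i := fun h => hq.1 (congrArg _ h)
      simp [h]
    · have h : q ≠ i := fun h => hq.2 (congrArg _ h)
      simp [h]

theorem encodes_diagonal_update (i : Q) {x : Rat2} (hx : x ≠ 0) :
    Encodes (diagonal (Function.update 1 i x)) := by
  obtain ⟨p, q, hq, rfl⟩ := IsFractionRing.div_surjective (A := Lau) x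
  have hp : p ≠ 0 := by rintro rfl; simp at hx
  have h := (encodes_diagonal_algebraMap i hp).mul
    (encodes_diagonal_inv i (nonZeroDivisors.ne_zero hq))
  rw [diagonal_mul_diagonal] at h
  refine cast (congrArg (fun d => Encodes (diagonal d)) (funext fun x => ?_)) h
  by_cases hx : x = i
  · subst hx; simp [div_eq_mul_inv]
  · simp [hx]

theorem encodes_diagonal (d : Q → Rat2) (hd : ∀ q, d q ≠ 0) : Encodes (diagonal d) := by
  have key : ∀ s : Finset Q, Encodes (diagonal (s.piecewise d 1)) := fun s => by
    induction s using Finset.induction_on with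
    | empty => exact ⟨[], by simp [circuitMat]⟩
    | insert a s ha ih =>
      have h := (encodes_diagonal_update a (hd a)).mul ih
      rw [diagonal_mul_diagonal] at h
      refine cast (congrArg (fun d => Encodes (diagonal d)) (funext fun x => ?_)) h
      by_cases hx : x = a
      · subst hx; simp [ha]
      · simp [hx, Finset.piecewise]
  simpa using key Finset.univ

theorem encodes_transvection {i j : Q} (hij : i ≠ j) (x : Rat2) :
    Encodes (transvection i j x) := by
  obtain ⟨p, q, hq, rfl⟩ := IsFractionRing.div_surjective (A := Lau) x
  have hq0 := nonZeroDivisors.ne_zero hq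
  have hq' : algebraMap Lau Rat2 q ≠ 0 := by simpa using hq0
  have h1 : Encodes (toRat (transvection i j p)) := by
    obtain ⟨gs, hg⟩ := exists_finCircuit_transvection hij p
    refine ⟨gs.map Gate.fin, ?_⟩
    rw [circuitMat_map_fin, hg]
    congr 1
    have hinv : (toRat (transvection i j p))⁻¹ = toRat (transvection i j p) := by
      apply Matrix.inv_eq_right_inv
      rw [← toRat_mul, transvection_mul_transvection_same _ _ hij, CharTwo.add_self_eq_zero,
        transvection_zero, toRat_one]
    rw [hinv, ← toRat_conjTranspose, conjTranspose_transvection]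
  have h := ((encodes_diagonal_inv i hq0).mul h1).mul (encodes_diagonal_algebraMap i hq0)
  convert h using 1
  ext a b
  rw [mul_diagonal, diagonal_mul, toRat_transvection]
  simp only [transvection, Matrix.add_apply, Matrix.one_apply, Matrix.single_apply]
  by_cases ha : a = i
  · subst ha
    by_cases hb : b = a
    · subst hb
      simp [hij.symm, hq']
    · by_cases hb' : j = b
      · subst hb'; simp [hij, Ne.symm hij, div_eq_mul_inv, mul_comm]
      · simp [hb, hb', Ne.symm hb]
  · by_cases hb : b = i
    · subst hb; simp [ha, Ne.symm ha]
    · simp [ha, Ne.symm ha, hb]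

/-- Infinite-depth operations make every nonsingular rational change of basis encodable. -/
theorem encodes_of_det_ne_zero (V : Matrix Q Q Rat2) (hV : V.det ≠ 0) : Encodes V :=
  diagonal_transvection_induction_of_det_ne_zero Encodes V hV
    (fun d hd => encodes_diagonal d fun q h => hd (by
      rw [det_diagonal]; exact Finset.prod_eq_zero (Finset.mem_univ q) h))
    (fun t => encodes_transvection t.hij t.c) fun _ _ _ _ hA hB => hA.mul hB

theorem exists_circuit (V Vd : Matrix Q Q Rat2) (h : V * Vdᴴ = 1) :
    ∃ gs : List (Gate Q), circuitMat gs = fromBlocks V 0 0 Vd := by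
  have hdet : V.det ≠ 0 := fun h0 => by
    have := congrArg det h
    rw [det_mul, h0, zero_mul, det_one] at this
    exact zero_ne_one this
  obtain ⟨gs, hg⟩ := encodes_of_det_ne_zero V hdet
  rw [Matrix.inv_eq_right_inv h, conjTranspose_conjTranspose] at hg
  exact ⟨gs, hg⟩

end Circuits

/-! ### Ranks of check matrices -/

theorem le_of_delayFree {k n : ℕ} {G : Matrix (Fin k) (Fin n) (RatFunc (ZMod 2))}
    (h : DelayFree G) : k ≤ n := by
  simpa using LinearIndependent.fintype_card_le_finrank h

/-- The kernel of `H` over the Laurent series is the code, which has dimension at most `k`; the rank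
does not change in passing from `Rat2` to Laurent series. -/
theorem rank_of_isCheckMatrix {k n : ℕ} {G : Matrix (Fin k) (Fin n) (RatFunc (ZMod 2))}
    {H : Matrix (Fin (n - k)) (Fin n) (Polynomial (ZMod 2))}
    (hH : IsCheckMatrix H (convCode G)) :
    (toRat (H.map Polynomial.toLaurent)).rank = n - k := by
  set A := H.map (algebraMap (Polynomial (ZMod 2)) Seq) with hA
  have hker : LinearMap.ker A.mulVecLin ≤ LinearMap.range ((G.map expand)ᵀ).mulVecLin := by
    intro v hv
    obtain ⟨u, hu⟩ := (hH v).2 hv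
    refine ⟨u, ?_⟩
    rw [← hu, encodeSeq, Matrix.mulVecLin_apply, Matrix.mulVec_transpose]
  have h1 := (Submodule.finrank_mono hker).trans (Matrix.rank_le_width ((G.map expand)ᵀ))
  have h2 := LinearMap.finrank_range_add_finrank_ker A.mulVecLin
  rw [Module.finrank_fintype_fun_eq_card, Fintype.card_fin] at h2
  have h3 : A.rank = n - k := by
    refine le_antisymm (Matrix.rank_le_height A) ?_
    rw [Matrix.rank]
    omega
  have hS : LinearIndependent Seq A.row := by
    rw [linearIndependent_iff_card_eq_finrank_span, Fintype.card_fin]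
    exact h3.symm.trans (Matrix.rank_eq_finrank_span_row A)
  have hL : LinearIndependent Lau (H.map Polynomial.toLaurent).row := by
    rw [← Matrix.vecMul_injective_iff] at hS ⊢
    refine (injective_iff_map_eq_zero (H.map Polynomial.toLaurent).vecMulLinear).2 fun u hu => ?_
    obtain ⟨m, p, hp⟩ := exists_polynomial_multiple u
    have hpu : (fun x => Polynomial.toLaurent (p x)) = (LaurentPolynomial.T m : Lau) • u := by
      ext1 x
      rw [hp, Pi.smul_apply, smul_eq_mul, mul_comm]
    have h4 : p ᵥ* H = 0 := by
      ext1 j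
      apply Polynomial.toLaurent_injective
      rw [RingHom.map_vecMul, show Polynomial.toLaurent ∘ p = _ from hpu, Matrix.smul_vecMul,
        show u ᵥ* H.map Polynomial.toLaurent = 0 from hu]
      simp
    have h6 : (fun x => algebraMap (Polynomial (ZMod 2)) Seq (p x)) = 0 := by
      apply hS
      ext1 j
      have h5 := RingHom.map_vecMul (algebraMap (Polynomial (ZMod 2)) Seq) H p j
      rw [h4, Pi.zero_apply, map_zero] at h5
      exact h5.symm.trans (congrFun (Matrix.zero_vecMul A) j).symm
    ext1 x
    have h7 : p x = 0 := (map_eq_zero_iff _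
      (FaithfulSMul.algebraMap_injective (Polynomial (ZMod 2)) Seq)).1 (congrFun h6 x)
    have h8 := hp x
    rw [h7, map_zero] at h8
    exact ((LaurentPolynomial.isUnit_T m).mul_left_eq_zero).1 h8.symm
  simpa [toRat] using (linearIndependent_map_row Rat2 hL).rank_matrix

/-! ### The normal form of a pair of check matrices -/

theorem isUnit_det_toRat {r : ℕ} {P : Matrix (Fin r) (Fin r) Lau} (h : P.det ≠ 0) :
    IsUnit (toRat P).det := by
  rw [show (toRat P).det = algebraMap Lau Rat2 P.det from (RingHom.map_det _ _).symm,
    isUnit_iff_ne_zero]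
  simpa using h

/-- A rank factorization `B * C` of `A₁ * A₂ᴴ` over the Laurent polynomials, completed to nonsingular
row operations `P₁`, `P₂` that take generators `Z`, `X` in normal form, `c` anticommuting pairs and
otherwise commuting, to the given ones. -/
theorem exists_normalForm {r₁ r₂ c : ℕ} {N α₁ α₂ : Type} [Fintype N] [DecidableEq N] [Fintype α₁]
    [Fintype α₂] [DecidableEq α₁] [DecidableEq α₂] (A₁ : Matrix (Fin r₁) N Lau)
    (A₂ : Matrix (Fin r₂) N Lau) (hc : (toRat (A₁ * A₂ᴴ)).rank = c)
    (e₁ : Fin r₁ ≃ Fin c ⊕ α₁) (e₂ : Fin r₂ ≃ Fin c ⊕ α₂) :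
    ∃ (B : Matrix (Fin r₁) (Fin c) Lau) (C : Matrix (Fin c) (Fin r₂) Lau)
      (P₁ : Matrix (Fin r₁) (Fin r₁) Lau) (P₂ : Matrix (Fin r₂) (Fin r₂) Lau)
      (Z : Matrix (Fin r₁) N Rat2) (X : Matrix (Fin r₂) N Rat2),
      A₁ * A₂ᴴ = B * C ∧ P₁.det ≠ 0 ∧ P₂.det ≠ 0 ∧
      P₁.submatrix id (e₁.symm ∘ Sum.inl) = B ∧ P₂.submatrix id (e₂.symm ∘ Sum.inl) = Cᴴ ∧
      toRat P₁ * Z = toRat A₁ ∧ toRat P₂ * X = toRat A₂ ∧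
      Z * Xᴴ = (fromBlocks 1 0 0 0 : Matrix (Fin c ⊕ α₁) (Fin c ⊕ α₂) Rat2).submatrix e₁ e₂ := by
  obtain ⟨B, C, hBC⟩ := exists_rank_factorization Rat2 (A₁ * A₂ᴴ) c hc
  have hc' : (toRat B * toRat C).rank = c := by rw [← toRat_mul, ← hBC, hc]
  have hBr : (toRat B).rank = Fintype.card (Fin c) := by
    refine le_antisymm (Matrix.rank_le_card_width _) ?_
    rw [Fintype.card_fin]
    exact hc'.ge.trans (Matrix.rank_mul_le_left _ _)
  have hCr : (toRat Cᴴ).rank = Fintype.card (Fin c) := by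
    refine le_antisymm (Matrix.rank_le_card_width _) ?_
    rw [toRat_conjTranspose]
    refine le_trans ?_ (rank_le_rank_conjTranspose _)
    rw [Fintype.card_fin]
    exact hc'.ge.trans (Matrix.rank_mul_le_right _ _)
  obtain ⟨P₁, hP₁, hPB⟩ := exists_nonsingular_completion Rat2 B e₁ hBr
  obtain ⟨P₂, hP₂, hPC⟩ := exists_nonsingular_completion Rat2 Cᴴ e₂ hCr
  have hu₁ := isUnit_det_toRat hP₁
  have hu₂ := isUnit_det_toRat hP₂
  have hprod : toRat (A₁ * A₂ᴴ) = toRat P₁ *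
      (fromBlocks 1 0 0 0 : Matrix (Fin c ⊕ α₁) (Fin c ⊕ α₂) Rat2).submatrix e₁ e₂ *
        (toRat P₂)ᴴ := by
    rw [← toRat_conjTranspose, hBC]
    ext r s
    rw [toRat_mul, Matrix.mul_apply, Matrix.mul_apply, ← Equiv.sum_comp e₂.symm,
      Fintype.sum_sum_type]
    have h0 : ∀ y, (toRat P₁ * (fromBlocks 1 0 0 0 :
        Matrix (Fin c ⊕ α₁) (Fin c ⊕ α₂) Rat2).submatrix e₁ e₂) r (e₂.symm y) =
          Sum.elim (fun i => toRat B r i) 0 y := fun y => by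
      rw [Matrix.mul_apply, ← Equiv.sum_comp e₁.symm, Fintype.sum_sum_type]
      rcases y with y | y <;> simp [Matrix.one_apply, toRat, hPB]
    simp only [h0, Sum.elim_inl, Sum.elim_inr, Pi.zero_apply, zero_mul, Finset.sum_const_zero,
      add_zero]
    refine Finset.sum_congr rfl fun i _ => ?_
    simp only [toRat, map_apply, conjTranspose_apply, hPC, star_star]
  refine ⟨B, C, P₁, P₂, (toRat P₁)⁻¹ * toRat A₁, (toRat P₂)⁻¹ * toRat A₂, hBC, hP₁, hP₂, ?_, ?_,
    ?_, ?_, ?_⟩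
  · exact Matrix.ext hPB
  · exact Matrix.ext hPC
  · exact Matrix.mul_nonsing_inv_cancel_left _ _ hu₁
  · exact Matrix.mul_nonsing_inv_cancel_left _ _ hu₂
  · have hu₂' : (toRat P₂)ᴴ * ((toRat P₂)⁻¹)ᴴ = 1 := by
      rw [← Matrix.conjTranspose_mul, Matrix.nonsing_inv_mul _ hu₂, Matrix.conjTranspose_one]
    rw [Matrix.conjTranspose_mul, ← toRat_conjTranspose A₂, Matrix.mul_assoc,
      ← Matrix.mul_assoc (toRat A₁), ← toRat_mul, hprod, Matrix.mul_assoc, hu₂', Matrix.mul_one,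
      Matrix.nonsing_inv_mul_cancel_left _ _ hu₁]

theorem exists_rightInverse_of_mul {r : ℕ} {N : Type} [Fintype N] [DecidableEq N]
    {P : Matrix (Fin r) (Fin r) Rat2} {Z A : Matrix (Fin r) N Rat2} (h : P * Z = A)
    (hA : A.rank = r) : ∃ Y : Matrix N (Fin r) Rat2, Z * Y = 1 := by
  obtain ⟨Y, hY⟩ := exists_rightInverse_of_rank A (by simpa using hA)
  refine ⟨Y * P, ?_⟩
  rw [← h, Matrix.mul_assoc] at hY
  rw [← Matrix.mul_assoc]
  exact mul_eq_one_comm.1 hY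

theorem toRat_mul_submatrix_one {r c : ℕ} {α : Type} {e : Fin r ≃ Fin c ⊕ α}
    {P : Matrix (Fin r) (Fin r) Lau} {B : Matrix (Fin r) (Fin c) Lau}
    (hB : P.submatrix id (e.symm ∘ Sum.inl) = B) :
    toRat P * (1 : Matrix (Fin r) (Fin r) Rat2).submatrix id (e.symm ∘ Sum.inl) = toRat B := by
  rw [← hB]
  exact Matrix.mul_submatrix_one (Equiv.refl _) _ _

/-- Operators `F = (F₁ | F₂)` that commute with the extended generators `(B | A)`, expressed through
the generators `Z` in normal form. -/
theorem mul_conjTranspose_of_commute {r c : ℕ} {N α κ : Type} [Fintype N] [Fintype α]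
    {e : Fin r ≃ Fin c ⊕ α} {P : Matrix (Fin r) (Fin r) Lau} {B : Matrix (Fin r) (Fin c) Lau}
    {A : Matrix (Fin r) N Lau} {Z : Matrix (Fin r) N Rat2} {F : Matrix κ (Fin c ⊕ N) Lau}
    (hP : P.det ≠ 0) (hB : P.submatrix id (e.symm ∘ Sum.inl) = B) (hZ : toRat P * Z = toRat A)
    (hF : fromCols B A * Fᴴ = 0) :
    Z.submatrix (e.symm ∘ Sum.inl) id * (toRat F.toCols₂)ᴴ = (toRat F.toCols₁)ᴴ ∧
      Z.submatrix (e.symm ∘ Sum.inr) id * (toRat F.toCols₂)ᴴ = 0 := by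
  let J : Matrix (Fin r) (Fin c) Rat2 := (1 : Matrix _ _ Rat2).submatrix id (e.symm ∘ Sum.inl)
  have hJ : toRat P * J = toRat B := toRat_mul_submatrix_one hB
  have h1 : Z * (toRat F.toCols₂)ᴴ = J * (toRat F.toCols₁)ᴴ := by
    have h2 : toRat P * (J * (toRat F.toCols₁)ᴴ + Z * (toRat F.toCols₂)ᴴ) = 0 := by
      rw [Matrix.mul_add, ← Matrix.mul_assoc, ← Matrix.mul_assoc, hJ, hZ, ← toRat_conjTranspose,
        ← toRat_conjTranspose, ← toRat_mul, ← toRat_mul]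
      have h3 : B * F.toCols₁ᴴ + A * F.toCols₂ᴴ = 0 := by
        rw [← hF, ← fromCols_mul_fromRows, ← conjTranspose_fromCols_eq_fromRows_conjTranspose,
          fromCols_toCols]
      have h4 := congrArg toRat h3
      rw [toRat, Matrix.map_add _ (map_add _)] at h4
      rw [show toRat _ + toRat _ = _ from h4]
      exact Matrix.map_zero _ (map_zero _)
    have h5 : J * (toRat F.toCols₁)ᴴ + Z * (toRat F.toCols₂)ᴴ = 0 := by
      rw [← Matrix.nonsing_inv_mul_cancel_left (toRat P) (_ + _) (isUnit_det_toRat hP), h2,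
        Matrix.mul_zero]
    refine Matrix.ext fun i j => (CharTwo.add_eq_zero.1 (congrFun (congrFun h5 i) j)).symm
  constructor
  · have := congrArg (fun Y => Y.submatrix (e.symm ∘ Sum.inl) id) h1
    ext i j
    have := congrFun (congrFun this i) j
    simpa [Matrix.mul_apply, J, Matrix.one_apply] using this
  · ext i j
    have := congrFun (congrFun h1 (e.symm (Sum.inr i))) j
    simpa [Matrix.mul_apply, J, Matrix.one_apply] using this

/-- In normal form, the `r₁ - c` independent rows of `Z` outside the anticommuting pairs are orthogonal
to the `r₂` independent rows of `X`. -/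
theorem rank_add_rank_le {r₁ r₂ n c : ℕ} (A₁ : Matrix (Fin r₁) (Fin n) Lau)
    (A₂ : Matrix (Fin r₂) (Fin n) Lau) (h₁ : (toRat A₁).rank = r₁) (h₂ : (toRat A₂).rank = r₂)
    (hc : (toRat (A₁ * A₂ᴴ)).rank = c) : r₁ + r₂ ≤ n + c := by
  have hc₁ : c ≤ r₁ := hc ▸ Matrix.rank_le_height _
  have hc₂ : c ≤ r₂ := hc ▸ (Matrix.rank_le_card_width _).trans (by simp)
  obtain ⟨e₁⟩ : Nonempty (Fin r₁ ≃ Fin c ⊕ Fin (r₁ - c)) :=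
    ⟨(finCongr (by omega)).trans finSumFinEquiv.symm⟩
  obtain ⟨e₂⟩ : Nonempty (Fin r₂ ≃ Fin c ⊕ Fin (r₂ - c)) :=
    ⟨(finCongr (by omega)).trans finSumFinEquiv.symm⟩
  obtain ⟨B, C, P₁, P₂, Z, X, -, -, -, -, -, hZ, hX, hZX⟩ := exists_normalForm A₁ A₂ hc e₁ e₂
  obtain ⟨Y, hY⟩ := exists_rightInverse_of_mul hZ h₁
  obtain ⟨Y', hY'⟩ := exists_rightInverse_of_mul hX h₂
  have h3 : Z.submatrix (e₁.symm ∘ Sum.inr) id * Xᴴ = 0 := by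
    ext i j
    have := congrFun (congrFun hZX (e₁.symm (Sum.inr i))) j
    rcases h : e₂ j with x | x <;> simpa [Matrix.mul_apply, h] using this
  have h4 : Z.submatrix (e₁.symm ∘ Sum.inr) id * Y.submatrix id (e₁.symm ∘ Sum.inr) = 1 := by
    rw [← Matrix.submatrix_mul _ _ _ id _ Function.bijective_id, hY]
    exact Matrix.submatrix_one _ (e₁.symm.injective.comp Sum.inr_injective)
  have h5 := rank_add_rank_le_card_of_mul_eq_zero h3
  have h6 := rank_le_rank_conjTranspose X
  rw [rank_eq_card_of_rightInverse h4] at h5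
  rw [rank_eq_card_of_rightInverse hY'] at h6
  simp only [Fintype.card_fin] at h5 h6
  omega

/-! ### The lower bound on the number of ebits -/

/-- The receiver's columns `B₁`, `B₂` of a commuting extension satisfy `A₁ * A₂ᴴ = B₁ * (B₂ J)ᴴ` and
`B₁ * (B₁ J)ᴴ = 0`, where `J` swaps the "Z" and the "X" columns; the latter bounds the rank of `B₁`. -/
theorem rank_le_of_commuting {ρ₁ ρ₂ N : Type} [Fintype ρ₁] [Fintype ρ₂] [Fintype N] {c : ℕ}
    (A₁ : Matrix ρ₁ N Lau) (A₂ : Matrix ρ₂ N Lau)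
    (M : Matrix (ρ₁ ⊕ ρ₂) ((Fin c ⊕ N) ⊕ (Fin c ⊕ N)) Lau)
    (hM : senderPart M = fromBlocks A₁ 0 0 A₂) (hcomm : Commuting M) :
    (toRat (A₁ * A₂ᴴ)).rank ≤ c := by
  let B₁ : Matrix ρ₁ (Fin c ⊕ Fin c) Lau := M.submatrix Sum.inl (Sum.map Sum.inl Sum.inl)
  let B₂ : Matrix ρ₂ (Fin c ⊕ Fin c) Lau := M.submatrix Sum.inr (Sum.map Sum.inl Sum.inl)
  have hs : ∀ r x, M r (Sum.map Sum.inr Sum.inr x) = fromBlocks A₁ 0 0 A₂ r x :=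
    fun r x => congrFun (congrFun hM r) x
  have hz : ∀ r q, M r (Sum.inl (Sum.inr q)) = fromBlocks A₁ 0 0 A₂ r (Sum.inl q) :=
    fun r q => hs r (Sum.inl q)
  have hx : ∀ r q, M r (Sum.inr (Sum.inr q)) = fromBlocks A₁ 0 0 A₂ r (Sum.inr q) :=
    fun r q => hs r (Sum.inr q)
  have h11 : B₁ * (B₁.submatrix id Sum.swap)ᴴ = 0 := by
    refine Matrix.ext fun r r' => ?_
    have h := hcomm (Sum.inl r') (Sum.inl r)
    simp only [shiftedSymp, Fintype.sum_sum_type, hz, hx, fromBlocks_apply₁₁, fromBlocks_apply₁₂,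
      Matrix.zero_apply, map_zero, mul_zero, zero_mul, add_zero, Finset.sum_const_zero,
      Finset.sum_add_distrib] at h
    rw [Matrix.zero_apply, ← h, Matrix.mul_apply, Fintype.sum_sum_type, add_comm]
    simp only [mul_comm (LaurentPolynomial.invert _)]
    rfl
  have h12 : A₁ * A₂ᴴ = B₁ * (B₂.submatrix id Sum.swap)ᴴ := by
    refine Matrix.ext fun r r' => ?_
    have h := hcomm (Sum.inr r') (Sum.inl r)
    simp only [shiftedSymp, Fintype.sum_sum_type, hz, hx, fromBlocks_apply₁₁, fromBlocks_apply₁₂,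
      fromBlocks_apply₂₁, fromBlocks_apply₂₂,
      Matrix.zero_apply, map_zero, mul_zero,
      Finset.sum_add_distrib, Finset.sum_const_zero, add_zero] at h
    rw [← add_assoc, CharTwo.add_eq_zero] at h
    rw [Matrix.mul_apply, Matrix.mul_apply, Fintype.sum_sum_type, add_comm]
    simp only [mul_comm (LaurentPolynomial.invert _)] at h
    exact h.symm
  -- the receiver's parts of the first generators span an isotropic space of dimension at most `c`
  have h1 := rank_add_rank_le_card_of_mul_eq_zero
    (show toRat B₁ * (toRat (B₁.submatrix id Sum.swap))ᴴ = 0 by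
      rw [← toRat_conjTranspose, ← toRat_mul, h11]; ext; simp [toRat])
  have h2 := rank_le_rank_conjTranspose (toRat (B₁.submatrix id Sum.swap))
  have h3 : (toRat (B₁.submatrix id Sum.swap)).rank = (toRat B₁).rank :=
    Matrix.rank_submatrix (toRat B₁) (Equiv.refl _) (Equiv.sumComm _ _)
  have h4 : (toRat (A₁ * A₂ᴴ)).rank ≤ (toRat B₁).rank := by
    rw [h12, toRat_mul]; exact Matrix.rank_mul_le_left _ _
  simp only [Fintype.card_sum, Fintype.card_fin] at h1
  omega

/-! ### The code -/

theorem pauliZ_vecMul_onSender {A B : Type} [Fintype A] [Fintype B] [DecidableEq A] [DecidableEq B]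
    (E : Matrix (A ⊕ A) (A ⊕ A) Rat2) (q : B ⊕ A) :
    pauliZ q ᵥ* onSender B E = Sum.elim
      (fun b => Sum.elim (Sum.elim (Pi.single b 1) 0) 0)
      (fun a => Sum.elim (Sum.elim (fun _ => 0) (fun a' => E (Sum.inl a) (Sum.inl a')))
        (Sum.elim (fun _ => 0) (fun a' => E (Sum.inl a) (Sum.inr a')))) q := by
  rw [pauliZ, Matrix.single_one_vecMul]
  ext x
  rcases q with b | a <;> rcases x with (x | x) | (x | x) <;>
    simp [onSender, Matrix.one_apply, Pi.single_apply, eq_comm]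

theorem pauliX_vecMul_onSender {A B : Type} [Fintype A] [Fintype B] [DecidableEq A] [DecidableEq B]
    (E : Matrix (A ⊕ A) (A ⊕ A) Rat2) (q : B ⊕ A) :
    pauliX q ᵥ* onSender B E = Sum.elim
      (fun b => Sum.elim (fun _ => 0) (Sum.elim (Pi.single b 1) 0))
      (fun a => Sum.elim (Sum.elim (fun _ => 0) (fun a' => E (Sum.inr a) (Sum.inl a')))
        (Sum.elim (fun _ => 0) (fun a' => E (Sum.inr a) (Sum.inr a')))) q := by
  rw [pauliX, Matrix.single_one_vecMul]
  ext x
  rcases q with b | a <;> rcases x with (x | x) | (x | x) <;>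
    simp [onSender, Matrix.one_apply, Pi.single_apply, eq_comm]

/-- The encoder: given dual bases `V`, `Vd`, whose rows are labelled by the halves of ebits, the
ancillas of two kinds and the information qubits, a circuit takes the ancillas of the first kind to
the "Z" operators `V`, and those of the second kind, by Hadamard gates first, to the "X" operators
`Vd`. -/
theorem exists_encoder {Q γ α₁ α₂ κ : Type} [Fintype Q] [DecidableEq Q] [Fintype γ] [Fintype α₁]
    [Fintype α₂] [Fintype κ] [DecidableEq γ] [DecidableEq α₁] [DecidableEq α₂] [DecidableEq κ]
    (l : γ ⊕ (α₁ ⊕ α₂) ⊕ κ ≃ Q) (V Vd : Matrix (γ ⊕ (α₁ ⊕ α₂) ⊕ κ) Q Rat2) (h : V * Vdᴴ = 1) :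
    ∃ gs : List (Gate Q),
      (∀ i, circuitMat gs (Sum.inl (l (Sum.inl i))) = Sum.elim (V (Sum.inl i)) 0) ∧
      (∀ i, circuitMat gs (Sum.inr (l (Sum.inl i))) = Sum.elim (fun _ => 0) (Vd (Sum.inl i))) ∧
      (∀ i, circuitMat gs (Sum.inl (l (Sum.inr (Sum.inl (Sum.inl i))))) =
        Sum.elim (V (Sum.inr (Sum.inl (Sum.inl i)))) 0) ∧
      (∀ i, circuitMat gs (Sum.inl (l (Sum.inr (Sum.inl (Sum.inr i))))) =
        Sum.elim (fun _ => 0) (Vd (Sum.inr (Sum.inl (Sum.inr i))))) ∧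
      (∀ i, circuitMat gs (Sum.inl (l (Sum.inr (Sum.inr i)))) =
        Sum.elim (V (Sum.inr (Sum.inr i))) 0) ∧
      (∀ i, circuitMat gs (Sum.inr (l (Sum.inr (Sum.inr i)))) =
        Sum.elim (fun _ => 0) (Vd (Sum.inr (Sum.inr i)))) := by
  have h' : V.submatrix l.symm id * (Vd.submatrix l.symm id)ᴴ = 1 := by
    rw [conjTranspose_submatrix, ← Matrix.submatrix_mul _ _ _ id _ Function.bijective_id, h,
      Matrix.submatrix_one_equiv]
  obtain ⟨gs, hg⟩ := exists_circuit _ _ h'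
  obtain ⟨hs, hh⟩ := exists_hadamards
    (Finset.univ.filter fun q => ∃ i, l.symm q = Sum.inr (Sum.inl (Sum.inr i)))
  have key := hh (circuitMat gs)
  rw [← circuitMat_append] at key
  have hz : ∀ x, circuitMat gs (Sum.inl (l x)) = Sum.elim (V x) 0 := fun x => by
    rw [hg]; ext y; rcases y with y | y <;> simp
  have hx : ∀ x, circuitMat gs (Sum.inr (l x)) = Sum.elim (fun _ => 0) (Vd x) := fun x => by
    rw [hg]; ext y; rcases y with y | y <;> simp
  refine ⟨hs ++ gs, fun i => ?_, fun i => ?_, fun i => ?_, fun i => ?_, fun i => ?_, fun i => ?_⟩ <;>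
    first | rw [(key _).1] | rw [(key _).2]
  all_goals simp [hz, hx]

section Bare
variable {n k a c : ℕ} (lab : Fin c ⊕ Fin a ⊕ Fin k ≃ Fin n)
  (E : Matrix (Fin n ⊕ Fin n) (Fin n ⊕ Fin n) Rat2)

theorem bareStabilizer_mul_ebitZ (i : Fin c) :
    (bareStabilizer lab * onSender (Fin c) E) (Sum.inl i) = Sum.elim
      (Sum.elim (Pi.single i 1) fun q => E (Sum.inl (lab (Sum.inl i))) (Sum.inl q))
      (Sum.elim (fun _ => 0) fun q => E (Sum.inl (lab (Sum.inl i))) (Sum.inr q)) := by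
  have h : bareStabilizer lab (Sum.inl i) =
      pauliZ (Sum.inl i) + pauliZ (Sum.inr (lab (Sum.inl i))) := rfl
  rw [Matrix.mul_apply_eq_vecMul, h, Matrix.add_vecMul, pauliZ_vecMul_onSender,
    pauliZ_vecMul_onSender]
  ext x
  rcases x with (x | x) | (x | x) <;> simp [Pi.single_apply]

theorem bareStabilizer_mul_ebitX (i : Fin c) :
    (bareStabilizer lab * onSender (Fin c) E) (Sum.inr (Sum.inl i)) = Sum.elim
      (Sum.elim (fun _ => 0) fun q => E (Sum.inr (lab (Sum.inl i))) (Sum.inl q))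
      (Sum.elim (Pi.single i 1) fun q => E (Sum.inr (lab (Sum.inl i))) (Sum.inr q)) := by
  have h : bareStabilizer lab (Sum.inr (Sum.inl i)) =
      pauliX (Sum.inl i) + pauliX (Sum.inr (lab (Sum.inl i))) := rfl
  rw [Matrix.mul_apply_eq_vecMul, h, Matrix.add_vecMul, pauliX_vecMul_onSender,
    pauliX_vecMul_onSender]
  ext x
  rcases x with (x | x) | (x | x) <;> simp [Pi.single_apply]

theorem bareStabilizer_mul_ancilla (j : Fin a) :
    (bareStabilizer lab * onSender (Fin c) E) (Sum.inr (Sum.inr j)) = Sum.elim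
      (Sum.elim (fun _ => 0) fun q => E (Sum.inl (lab (Sum.inr (Sum.inl j)))) (Sum.inl q))
      (Sum.elim (fun _ => 0) fun q => E (Sum.inl (lab (Sum.inr (Sum.inl j)))) (Sum.inr q)) := by
  have h : bareStabilizer lab (Sum.inr (Sum.inr j)) =
      pauliZ (Sum.inr (lab (Sum.inr (Sum.inl j)))) := rfl
  rw [Matrix.mul_apply_eq_vecMul, h, pauliZ_vecMul_onSender]
  rfl

theorem bareLogical_mul_Z (i : Fin k) :
    (bareLogical lab * onSender (Fin c) E) (Sum.inl i) = Sum.elim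
      (Sum.elim (fun _ => 0) fun q => E (Sum.inl (lab (Sum.inr (Sum.inr i)))) (Sum.inl q))
      (Sum.elim (fun _ => 0) fun q => E (Sum.inl (lab (Sum.inr (Sum.inr i)))) (Sum.inr q)) := by
  have h : bareLogical lab (Sum.inl i) = pauliZ (Sum.inr (lab (Sum.inr (Sum.inr i)))) := rfl
  rw [Matrix.mul_apply_eq_vecMul, h, pauliZ_vecMul_onSender]
  rfl

theorem bareLogical_mul_X (i : Fin k) :
    (bareLogical lab * onSender (Fin c) E) (Sum.inr i) = Sum.elim
      (Sum.elim (fun _ => 0) fun q => E (Sum.inr (lab (Sum.inr (Sum.inr i)))) (Sum.inl q))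
      (Sum.elim (fun _ => 0) fun q => E (Sum.inr (lab (Sum.inr (Sum.inr i)))) (Sum.inr q)) := by
  have h : bareLogical lab (Sum.inr i) = pauliX (Sum.inr (lab (Sum.inr (Sum.inr i)))) := rfl
  rw [Matrix.mul_apply_eq_vecMul, h, pauliX_vecMul_onSender]
  rfl

theorem bareLogical_eq_fromBlocks : bareLogical lab = fromBlocks
    ((1 : Matrix (Fin c ⊕ Fin n) (Fin c ⊕ Fin n) Rat2).submatrix
      (fun i => Sum.inr (lab (Sum.inr (Sum.inr i)))) id) 0 0
    ((1 : Matrix (Fin c ⊕ Fin n) (Fin c ⊕ Fin n) Rat2).submatrix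
      (fun i => Sum.inr (lab (Sum.inr (Sum.inr i)))) id) := by
  refine Matrix.ext fun i x => ?_
  rcases i with i | i <;> rcases x with x | x <;>
    simp [bareLogical, pauliZ, pauliX, Pi.single_apply, Matrix.one_apply, @eq_comm _ x]

end Bare

/-- The rows of the two check matrices in normal form, matched with the unencoded generators. -/
def generatorEquiv {ρ₁ ρ₂ γ α₁ α₂ β : Type} (e₁ : ρ₁ ≃ γ ⊕ α₁) (e₂ : ρ₂ ≃ γ ⊕ α₂)
    (ea : β ≃ α₁ ⊕ α₂) : ρ₁ ⊕ ρ₂ ≃ γ ⊕ γ ⊕ β :=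
  (e₁.sumCongr e₂).trans ((Equiv.sumSumSumComm _ _ _ _).trans ((Equiv.sumAssoc _ _ _).trans
    ((Equiv.refl _).sumCongr ((Equiv.refl _).sumCongr ea.symm))))

theorem submatrix_generatorEquiv {ρ₁ ρ₂ γ α₁ α₂ β N : Type} [DecidableEq ρ₁] [DecidableEq ρ₂]
    [DecidableEq γ] (e₁ : ρ₁ ≃ γ ⊕ α₁) (e₂ : ρ₂ ≃ γ ⊕ α₂) (ea : β ≃ α₁ ⊕ α₂)
    {Z : Matrix ρ₁ N Rat2} {X : Matrix ρ₂ N Rat2}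
    {S : Matrix (γ ⊕ γ ⊕ β) ((γ ⊕ N) ⊕ (γ ⊕ N)) Rat2}
    (h₁ : ∀ i, S (Sum.inl i) =
      Sum.elim (Sum.elim (Pi.single i 1) (Z (e₁.symm (Sum.inl i)))) (fun _ => 0))
    (h₂ : ∀ i, S (Sum.inr (Sum.inl i)) =
      Sum.elim (fun _ => 0) (Sum.elim (Pi.single i 1) (X (e₂.symm (Sum.inl i)))))
    (h₃ : ∀ i, S (Sum.inr (Sum.inr (ea.symm (Sum.inl i)))) =
      Sum.elim (Sum.elim (fun _ => 0) (Z (e₁.symm (Sum.inr i)))) (fun _ => 0))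
    (h₄ : ∀ i, S (Sum.inr (Sum.inr (ea.symm (Sum.inr i)))) =
      Sum.elim (fun _ => 0) (Sum.elim (fun _ => 0) (X (e₂.symm (Sum.inr i))))) :
    S.submatrix (generatorEquiv e₁ e₂ ea) id = fromBlocks
      (fromCols ((1 : Matrix _ _ Rat2).submatrix id (e₁.symm ∘ Sum.inl)) Z) 0 0
      (fromCols ((1 : Matrix _ _ Rat2).submatrix id (e₂.symm ∘ Sum.inl)) X) := by
  refine Matrix.ext fun r x => ?_
  rcases r with r | r
  · obtain ⟨r, rfl⟩ := e₁.symm.surjective r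
    rcases r with r | r <;> rcases x with (x | x) | x <;>
      simp [generatorEquiv, h₁, h₃, Pi.single_apply, Matrix.one_apply, @eq_comm _ x]
  · obtain ⟨r, rfl⟩ := e₂.symm.surjective r
    rcases r with r | r <;> rcases x with x | (x | x) <;>
      simp [generatorEquiv, h₂, h₄, Pi.single_apply, Matrix.one_apply, @eq_comm _ x]

theorem toRat_mul_fromCols {r c : ℕ} {N α : Type} [Fintype N] {e : Fin r ≃ Fin c ⊕ α}
    {P : Matrix (Fin r) (Fin r) Lau} {B : Matrix (Fin r) (Fin c) Lau} {A : Matrix (Fin r) N Lau}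
    {Z : Matrix (Fin r) N Rat2} (hB : P.submatrix id (e.symm ∘ Sum.inl) = B)
    (hZ : toRat P * Z = toRat A) :
    toRat P * fromCols
      ((1 : Matrix (Fin r) (Fin r) Rat2).submatrix id (e.symm ∘ Sum.inl)) Z =
        toRat (fromCols B A) := by
  rw [mul_fromCols, hZ, toRat_mul_submatrix_one hB]
  exact (fromCols_map _ _ _).symm

theorem commuting_blockDiag {ρ₁ ρ₂ Q : Type} [Fintype Q] {M₁ : Matrix ρ₁ Q Lau}
    {M₂ : Matrix ρ₂ Q Lau} (h : M₁ * M₂ᴴ = 0) : Commuting (fromBlocks M₁ 0 0 M₂) := by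
  have hM : ∀ r r', ∑ q, M₁ r q * star (M₂ r' q) = 0 := fun r r' => by
    simpa [Matrix.mul_apply] using congrFun (congrFun h r) r'
  rintro (r | r) (r' | r')
  · simp [shiftedSymp]
  · have := congrArg star (hM r r')
    simpa [shiftedSymp, ← star_lau] using this
  · have := hM r' r
    simpa [shiftedSymp, ← star_lau, mul_comm] using this
  · simp [shiftedSymp]

/-- The extended generators are `(B | A₁)` and `(Cᴴ | A₂)` for a rank factorization `B * C` of
`A₁ * A₂ᴴ`. The shears that clear them off the information qubits give the decoder, and thereby the
encoded logical operators; the encoder takes the standard operators to these and the normal form. -/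
theorem isEAQCC_of_rank {n k c r₁ r₂ : ℕ} (A₁ : Matrix (Fin r₁) (Fin n) Lau)
    (A₂ : Matrix (Fin r₂) (Fin n) Lau) (h₁ : (toRat A₁).rank = r₁) (h₂ : (toRat A₂).rank = r₂)
    (hc : (toRat (A₁ * A₂ᴴ)).rank = c) (hk : r₁ + r₂ + k = n + c) :
    IsEAQCC n k c (fromBlocks A₁ 0 0 A₂) := by
  have hc₁ : c ≤ r₁ := hc ▸ Matrix.rank_le_height _
  have hc₂ : c ≤ r₂ := hc ▸ (Matrix.rank_le_card_width _).trans (by simp)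
  obtain ⟨e₁⟩ : Nonempty (Fin r₁ ≃ Fin c ⊕ Fin (r₁ - c)) :=
    ⟨(finCongr (by omega)).trans finSumFinEquiv.symm⟩
  obtain ⟨e₂⟩ : Nonempty (Fin r₂ ≃ Fin c ⊕ Fin (r₂ - c)) :=
    ⟨(finCongr (by omega)).trans finSumFinEquiv.symm⟩
  obtain ⟨B, C, P₁, P₂, Z, X, hBC, hP₁, hP₂, hPB, hPC, hZ, hX, hZX⟩ :=
    exists_normalForm A₁ A₂ hc e₁ e₂
  -- the extended generators, with the receiver's columns on the left
  let M₁ : Matrix (Fin r₁) (Fin c ⊕ Fin n) Lau := fromCols B A₁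
  let M₂ : Matrix (Fin r₂) (Fin c ⊕ Fin n) Lau := fromCols Cᴴ A₂
  have hM : M₁ * M₂ᴴ = 0 := by
    simp only [M₁, M₂, conjTranspose_fromCols_eq_fromRows_conjTranspose, fromCols_mul_fromRows,
      conjTranspose_conjTranspose, hBC]
    exact Matrix.ext fun _ _ => CharTwo.add_self_eq_zero _
  obtain ⟨N₁, hN₁⟩ := exists_rightInverse_of_rank (toRat A₁) (by simpa using h₁)
  obtain ⟨Y, hY⟩ := exists_rightInverse_of_mul hZ h₁
  obtain ⟨Y', hY'⟩ := exists_rightInverse_of_mul hX h₂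
  let ea : Fin (n - k - c) ≃ Fin (r₁ - c) ⊕ Fin (r₂ - c) :=
    (finCongr (by omega)).trans finSumFinEquiv.symm
  let l : Fin c ⊕ (Fin (r₁ - c) ⊕ Fin (r₂ - c)) ⊕ Fin k ≃ Fin n :=
    Fintype.equivOfCardEq (by simp; omega)
  let lab : Fin c ⊕ Fin (n - k - c) ⊕ Fin k ≃ Fin n :=
    ((Equiv.refl _).sumCongr (ea.sumCongr (Equiv.refl _))).trans l
  let ι : Fin k ↪ Fin c ⊕ Fin n := ⟨fun i => Sum.inr (l (Sum.inr (Sum.inr i))), fun i j h => by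
    simpa using h⟩
  obtain ⟨w, hw, hw₁, hw₂⟩ := exists_shears_pair M₁ M₂ hM
    ⟨fromRows 0 N₁, by
      rw [show toRat M₁ = fromCols (toRat B) (toRat A₁) from fromCols_map .., fromCols_mul_fromRows,
        hN₁, Matrix.mul_zero, zero_add]⟩
    (Finset.univ.map ι) (by simp; omega)
  obtain ⟨dec, hdec⟩ := exists_finCircuit_of_mem_shears hw
  have hww : w.2ᴴ * w.1 = 1 := mul_eq_one_comm.1 (mul_conjTranspose_of_mem_shears hw)
  have hww' : w.1ᴴ * w.2 = 1 := by simpa using congrArg conjTranspose hww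
  -- the logical operators that the decoder returns to the information qubits
  let F : Matrix (Fin k) (Fin c ⊕ Fin n) Lau := w.2ᴴ.submatrix ι id
  let F' : Matrix (Fin k) (Fin c ⊕ Fin n) Lau := w.1ᴴ.submatrix ι id
  have hF : M₂ * Fᴴ = 0 := by
    refine Matrix.ext fun r i => ?_
    simpa [F, Matrix.mul_apply] using hw₂ r (ι i) (by simp)
  have hF' : M₁ * F'ᴴ = 0 := by
    refine Matrix.ext fun r i => ?_
    simpa [F', Matrix.mul_apply] using hw₁ r (ι i) (by simp)
  have hFF : F * F'ᴴ = 1 := by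
    rw [conjTranspose_submatrix, conjTranspose_conjTranspose,
      ← Matrix.submatrix_mul _ _ _ id _ Function.bijective_id, hww]
    exact Matrix.submatrix_one _ ι.injective
  obtain ⟨hZe, hZa⟩ := mul_conjTranspose_of_commute hP₁ hPB hZ hF'
  obtain ⟨hXe, hXa⟩ := mul_conjTranspose_of_commute hP₂ hPC hX hF
  have hsub : ∀ {μ ν : Type} (f : μ → Fin c ⊕ Fin (r₁ - c)) (g : ν → Fin c ⊕ Fin (r₂ - c)),
      Z.submatrix (e₁.symm ∘ f) id * (X.submatrix (e₂.symm ∘ g) id)ᴴ =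
        (fromBlocks 1 0 0 0 : Matrix _ _ Rat2).submatrix f g := fun f g => by
    rw [conjTranspose_submatrix, ← Matrix.submatrix_mul _ _ _ id _ Function.bijective_id, hZX]
    ext i j
    simp
  have hY₁ : Z.submatrix (e₁.symm ∘ Sum.inr) id * Y.submatrix id (e₁.symm ∘ Sum.inr) = 1 := by
    rw [← Matrix.submatrix_mul _ _ _ id _ Function.bijective_id, hY]
    exact Matrix.submatrix_one _ (e₁.symm.injective.comp Sum.inr_injective)
  have hY₂ : X.submatrix (e₂.symm ∘ Sum.inr) id * Y'.submatrix id (e₂.symm ∘ Sum.inr) = 1 := by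
    rw [← Matrix.submatrix_mul _ _ _ id _ Function.bijective_id, hY']
    exact Matrix.submatrix_one _ (e₂.symm.injective.comp Sum.inr_injective)
  obtain ⟨V, Vd, hV, hVe, hVde, hVa, hVda, hVk, hVdk⟩ := exists_dual_completion
    ((hsub Sum.inl Sum.inl).trans (by ext; simp [Matrix.one_apply]))
    ((hsub Sum.inl Sum.inr).trans (by ext; simp))
    ((hsub Sum.inr Sum.inl).trans (by ext; simp))
    ((hsub Sum.inr Sum.inr).trans (by ext; simp))
    ⟨_, hY₁⟩ ⟨_, hY₂⟩
    (by simpa using congrArg conjTranspose hXe) (by simpa using congrArg conjTranspose hXa) hZe hZa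
    (by
      rw [add_comm, ← fromCols_mul_fromRows, ← conjTranspose_fromCols_eq_fromRows_conjTranspose,
        ← toRat_one, ← hFF, toRat_mul, toRat_conjTranspose]
      congr 1
      · exact Matrix.ext fun i x => by rcases x with x | x <;> rfl
      · exact congrArg _ (Matrix.ext fun i x => by rcases x with x | x <;> rfl))
  obtain ⟨enc, hE₁, hE₂, hE₃, hE₄, hE₅, hE₆⟩ := exists_encoder l V Vd hV
  simp only [hVe, hVde, hVa, hVda, hVk, hVdk] at hE₁ hE₂ hE₃ hE₄ hE₅ hE₆
  set b := toRat F.toCols₁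
  set a := toRat F.toCols₂
  set b' := toRat F'.toCols₁
  set a' := toRat F'.toCols₂
  set S := bareStabilizer lab * onSender (Fin c) (circuitMat enc) with hS
  have hl₁ : ∀ i, lab (Sum.inl i) = l (Sum.inl i) := fun _ => rfl
  have hl₂ : ∀ j, lab (Sum.inr (Sum.inl j)) = l (Sum.inr (Sum.inl (ea j))) := fun _ => rfl
  have hl₃ : ∀ i, lab (Sum.inr (Sum.inr i)) = l (Sum.inr (Sum.inr i)) := fun _ => rfl
  have hS₁ : ∀ i, S (Sum.inl i) =
      Sum.elim (Sum.elim (Pi.single i 1) (Z (e₁.symm (Sum.inl i)))) (fun _ => 0) := fun i => by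
    rw [hS, bareStabilizer_mul_ebitZ, hl₁, hE₁]
    exact congrArg _ (Sum.elim_const_const _)
  have hS₂ : ∀ i, S (Sum.inr (Sum.inl i)) =
      Sum.elim (fun _ => 0) (Sum.elim (Pi.single i 1) (X (e₂.symm (Sum.inl i)))) := fun i => by
    rw [hS, bareStabilizer_mul_ebitX, hl₁, hE₂]
    exact congrArg (fun f => Sum.elim f _) (Sum.elim_const_const _)
  have hSe : S.submatrix (generatorEquiv e₁ e₂ ea) id = _ :=
    submatrix_generatorEquiv e₁ e₂ ea hS₁ hS₂
      (fun i => by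
        rw [hS, bareStabilizer_mul_ancilla, hl₂, Equiv.apply_symm_apply, hE₃]
        exact congrArg _ (Sum.elim_const_const _))
      (fun i => by
        rw [hS, bareStabilizer_mul_ancilla, hl₂, Equiv.apply_symm_apply, hE₄]
        exact congrArg (fun f => Sum.elim f _) (Sum.elim_const_const _))
  let R : Matrix (Fin k ⊕ Fin k) (Fin c ⊕ Fin c ⊕ Fin (n - k - c)) Lau :=
    fromRows (fromCols F.toCols₁ 0) (fromCols 0 (fromCols F'.toCols₁ 0))
  -- the encoded logical operators, multiplied by the encoded ebit stabilizers that the rows of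
  -- `b`, `b'` select, are the Laurent polynomial operators `F`, `F'`
  have hL : bareLogical lab * onSender (Fin c) (circuitMat enc) =
      fromBlocks (toRat F) 0 0 (toRat F') + toRat R * S := by
    have hR : ∀ i, (toRat R * S) (Sum.inl i) = Sum.elim (Sum.elim (b i)
        ((b * Z.submatrix (e₁.symm ∘ Sum.inl) id) i)) (fun _ => 0) := fun i => by
      ext x
      rw [Matrix.mul_apply, Fintype.sum_sum_type, Fintype.sum_sum_type]
      rcases x with (x | x) | (x | x) <;>
        simp [R, toRat, hS₁, b, Matrix.mul_apply, Pi.single_apply]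
    have hR' : ∀ i, (toRat R * S) (Sum.inr i) = Sum.elim (fun _ => 0) (Sum.elim (b' i)
        ((b' * X.submatrix (e₂.symm ∘ Sum.inl) id) i)) := fun i => by
      ext x
      rw [Matrix.mul_apply, Fintype.sum_sum_type, Fintype.sum_sum_type]
      rcases x with (x | x) | (x | x) <;>
        simp [R, toRat, hS₂, b', Matrix.mul_apply, Pi.single_apply]
    refine Matrix.ext fun i x => ?_
    rw [Matrix.add_apply]
    rcases i with i | i
    · rw [bareLogical_mul_Z, hl₃, hE₅, hR]
      rcases x with (x | x) | (x | x)
      · exact (CharTwo.add_self_eq_zero _).symm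
      · rfl
      · exact (add_zero _).symm
      · exact (add_zero _).symm
    · rw [bareLogical_mul_X, hl₃, hE₆, hR']
      rcases x with (x | x) | (x | x)
      · exact (add_zero _).symm
      · exact (add_zero _).symm
      · exact (CharTwo.add_self_eq_zero _).symm
      · rfl
  have hdecF : fromBlocks (toRat F) 0 0 (toRat F') * finCircuitMat dec = bareLogical lab := by
    have h1 : F * w.1 = (1 : Matrix _ _ Lau).submatrix ι id := by
      rw [← hww]; rfl
    have h2 : F' * w.2 = (1 : Matrix _ _ Lau).submatrix ι id := by
      rw [← hww']; rfl
    rw [hdec, blockDiag_mul, ← toRat_mul, ← toRat_mul, h1, h2, bareLogical_eq_fromBlocks,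
      ← toRat_one]
    rfl
  refine ⟨lab, enc, dec, fromBlocks M₁ 0 0 M₂, R, ?_, ?_,
    ⟨generatorEquiv e₁ e₂ ea, fromBlocks P₁ 0 0 P₂, ?_, ?_⟩, ?_⟩
  · ext r x
    rcases r with r | r <;> rcases x with x | x <;> rfl
  · exact commuting_blockDiag hM
  · rw [det_fromBlocks_zero₂₁]
    exact mul_ne_zero hP₁ hP₂
  · rw [← hS, hSe, toRat_blockDiag, toRat_blockDiag, blockDiag_mul, toRat_mul_fromCols hPB hZ,
      toRat_mul_fromCols hPC hX]
  · rw [← hS, hL, Matrix.add_mul, hdecF, Matrix.mul_assoc]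

end QConv

end

theorem theorem1 (n k₁ k₂ : ℕ)
    (G₁ : Matrix (Fin k₁) (Fin n) (RatFunc (ZMod 2)))
    (G₂ : Matrix (Fin k₂) (Fin n) (RatFunc (ZMod 2)))
    (hG₁ : QConv.Realizable G₁) (hG₂ : QConv.Realizable G₂)
    (hdf₁ : QConv.DelayFree G₁) (hdf₂ : QConv.DelayFree G₂)
    (hnc₁ : QConv.Noncatastrophic G₁) (hnc₂ : QConv.Noncatastrophic G₂)
    (H₁ : Matrix (Fin (n - k₁)) (Fin n) (Polynomial (ZMod 2)))
    (H₂ : Matrix (Fin (n - k₂)) (Fin n) (Polynomial (ZMod 2)))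
    (hH₁ : QConv.IsCheckMatrix H₁ (QConv.convCode G₁))
    (hH₂ : QConv.IsCheckMatrix H₂ (QConv.convCode G₂)) :
    n ≤ k₁ + k₂ + QConv.ebitRank H₁ H₂ ∧
    QConv.IsEAQCC n (k₁ + k₂ + QConv.ebitRank H₁ H₂ - n) (QConv.ebitRank H₁ H₂)
      (QConv.cssMatrix H₁ H₂) ∧
    ∀ (c : ℕ) (M : Matrix (Fin (n - k₁) ⊕ Fin (n - k₂))
        ((Fin c ⊕ Fin n) ⊕ (Fin c ⊕ Fin n)) QConv.Lau),
      QConv.senderPart M = QConv.cssMatrix H₁ H₂ → QConv.Commuting M →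
        QConv.ebitRank H₁ H₂ ≤ c := by
  have hk₁ := QConv.le_of_delayFree hdf₁
  have hk₂ := QConv.le_of_delayFree hdf₂
  have h₁ := QConv.rank_of_isCheckMatrix hH₁
  have h₂ := QConv.rank_of_isCheckMatrix hH₂
  have hc : (QConv.toRat (H₁.map Polynomial.toLaurent *
      (H₂.map Polynomial.toLaurent).conjTranspose)).rank = QConv.ebitRank H₁ H₂ := rfl
  have hle := QConv.rank_add_rank_le _ _ h₁ h₂ hc
  exact ⟨by omega, QConv.isEAQCC_of_rank _ _ h₁ h₂ hc (by omega),
    fun c M hM hcomm => QConv.rank_le_of_commuting _ _ M hM hcomm⟩
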